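/- **Setting.** Let $F$ be a totally real number field with a fixed embedding $F\hookrightarrow\mathbb R$, let $\operatorname{sign}\colon F^*\to\{\pm1\}$ be the usual sign, and put $P=F^*/\{\pm1\}$. Let $\mathcal B$ be a totally indefinite quaternion division algebra over $F$ (with centre $F$), and $K$ a number field with absolute Galois group $G_K$. All cohomology is continuous, with trivial action and discrete coefficients. For a continuous morphism $\psi\colon G_K\to\mathcal B^*/F^*$, with $\psi(\sigma)=\psi_\sigma F^*$ and $\sigma\mapsto\psi_\sigma$ continuous, let $\delta(\psi)\in H^2(G_K,F^*)$ be the class of $(\sigma,\tau)\mapsto\psi_\sigma\psi_\tau\psi_{\sigma\tau}^{-1}$. For a group $\Gamma$, let $\Delta_\Gamma$ be the set of classes in $H^2(G_K,F^*)[2]$ of the form $\delta(\psi)$ with $\operatorname{im}\psi\simeq\Gamma$. A class $\gamma=[c]\in H^2(G_K,F^*)[2]$ has two components: $\gamma_\pm\in H^2(G_K,\{\pm1\})$, the class of $\operatorname{sign}(c)$, and $\overline\gamma\in\operatorname{Hom}(G_K,P/P^2)$, given by $\sigma\mapsto d_\sigma \bmod \{\pm1\}F^{*2}$, where $c(\sigma,\tau)^2=d_\sigma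 d_\tau d_{\sigma\tau}^{-1}$ with $d$ continuous. For $t\in K^*$ and $a\in F^*$, $(t,a)_P\in\operatorname{Hom}(G_K,P/P^2)$ is the inflation of the morphism sending the non-trivial automorphism of $K(\sqrt t)/K$ to the class of $a$ (it is trivial if $t$ is a square). For $a,b\in F^*$, $(a,b)_F$ is the quaternion algebra over $F$ with generators $i,j$ satisfying $i^2=a$, $j^2=b$, $ij=-ji$. **Proposition.** Let $n>2$, suppose that $\mathcal B^*/F^*$ contains a subgroup isomorphic to the dihedral group $D_{2n}$ of order $2n$, and let $\zeta_n\in\overline F$ be a primitive $n$-th root of unity. Then $\alpha=2+\zeta_n+\zeta_n^{-1}$ and $d=(\zeta_n+\zeta_n^{-1})^2-4$ lie in $F^*$, and a class $\gamma\in H^2(G_K,F^*)$ lies in $\Delta_{D_{2n}}$ if and only if it is $2$-torsion and there exist a Galois extension $M/K$ with $$\operatorname{Gal}(M/K)=\langle\sigma,\tau\mid\sigma^n=1,\ \tau^2=1,\ \sigma\tau=\tau\sigma^{-1}\rangle\simeq D_{2n}$$ and elements $s,t\in K^*$, $b\in F^*$ with $K(\sqrt s)=M^{\langle\sigma^2,\tau\rangle}$,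 $K(\sqrt t)=M^{\langle\sigma\rangle}$ and $\mathcal B\simeq(d,b)_F$, such that - $\overline\gamma=(s,\alpha)_P\cdot(t,b)_P$; - $\gamma_\pm$ is the class of the inflation to $G_K$ of the $2$-cocycle $c_\pm$ on $\operatorname{Gal}(M/K)$ given, for $0\le i,i'<n$ and $j'\in\{0,1\}$, by $$c_\pm(\sigma^i\tau,\sigma^{i'}\tau^{j'})=\begin{cases}1&\text{if } i-i'\ge0,\\-1&\text{if } i-i'<0,\end{cases}\qquad c_\pm(\sigma^i,\sigma^{i'}\tau^{j'})=\begin{cases}1&\text{if } i+i'<n,\\-1&\text{if } i+i'\ge n.\end{cases}$$ If $n$ is odd, then for every such $M,\sigma,\tau$ and every $s$ with $K(\sqrt s)=M^{\langle\sigma^2,\tau\rangle}$ the morphism $(s,\alpha)_P$ and the class of $c_\pm$ are trivial. Hence for odd $n$, $\gamma\in\Delta_{D_{2n}}$ if and only if $\gamma$ is $2$-torsion and there exist $M,\sigma,\tau$ as above, $t\in K^*$ with $K(\sqrt t)=M^{\langle\sigma\rangle}$ and $b\in F^*$ with $\mathcal B\simeq(d,b)_F$, such that $\overline\gamma=(t,b)_P$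 and $\gamma_\pm=1$. -/

import Mathlib

noncomputable section

namespace BuildingBlock

/-! ### Continuous cohomology in degree two, trivial action, discrete coefficients

A continuous map into a discrete set is the same as a locally constant map. -/

section Cohomology

variable (G : Type*) [Group G] [TopologicalSpace G] [IsTopologicalGroup G]
variable (A : Type*) [CommGroup A]

/-- The `2`-cocycle identity for the trivial action of a group on an abelian group. -/
def IsCocycle {Q C : Type*} [Group Q] [CommGroup C] (c : Q × Q → C) : Prop :=
  ∀ x y z : Q, c (x, y) * c (x * y, z) = c (y, z) * c (x, y * z)

/-- The group `Z²(G, A)` of continuous `2`-cocycles (trivial action, `A` discrete). -/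
def Z2 : Subgroup (G × G → A) where
  carrier := {c | IsLocallyConstant c ∧ IsCocycle c}
  one_mem' := ⟨IsLocallyConstant.const 1, fun _ _ _ => by simp⟩
  mul_mem' := by
    rintro c c' ⟨h1, h2⟩ ⟨h3, h4⟩
    refine ⟨h1.mul h3, fun x y z => ?_⟩
    simp only [Pi.mul_apply]
    rw [mul_mul_mul_comm, h2, h4, mul_mul_mul_comm]
  inv_mem' := by
    rintro c ⟨h1, h2⟩
    refine ⟨h1.inv, fun x y z => ?_⟩
    simp only [Pi.inv_apply]
    rw [← mul_inv, h2, mul_inv]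

variable {G A}

/-- The coboundary `(σ, τ) ↦ d_σ d_τ d_{στ}⁻¹` of a map `d : G → A`. -/
def coboundary (d : G → A) : G × G → A := fun p => d p.1 * d p.2 * (d (p.1 * p.2))⁻¹

variable (G A)

/-- The group `B²(G, A)` of coboundaries of continuous maps, as a subgroup of `Z²(G, A)`. -/
def B2 : Subgroup (Z2 G A) where
  carrier := {c | ∃ d : G → A, IsLocallyConstant d ∧ (c : G × G → A) = coboundary d}
  one_mem' := ⟨1, IsLocallyConstant.const 1, by ext; simp [coboundary]⟩
  mul_mem' := by
    rintro c c' ⟨d, h1, h2⟩ ⟨d', h3, h4⟩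
    refine ⟨d * d', h1.mul h3, ?_⟩
    ext p
    simp only [Subgroup.coe_mul, h2, h4, coboundary, Pi.mul_apply, mul_inv]
    rw [mul_mul_mul_comm, mul_mul_mul_comm (d p.1)]
  inv_mem' := by
    rintro c ⟨d, h1, h2⟩
    refine ⟨d⁻¹, h1.inv, ?_⟩
    ext p
    simp only [Subgroup.coe_inv, h2, coboundary, Pi.inv_apply, mul_inv]

/-- The continuous cohomology group `H²(G, A)`. -/
abbrev H2 : Type _ := Z2 G A ⧸ B2 G A

variable {G A}

/-- The cohomology class of a continuous `2`-cocycle. -/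
def H2.mk : Z2 G A →* H2 G A := QuotientGroup.mk' (B2 G A)

/-- A homomorphism of coefficients acting on cocycles. -/
def Z2.map {A' : Type*} [CommGroup A'] (f : A →* A') : Z2 G A →* Z2 G A' where
  toFun c := ⟨f ∘ c, c.2.1.comp f, fun x y z => by
    simp only [Function.comp_apply, ← map_mul]
    rw [c.2.2 x y z]⟩
  map_one' := by ext; simp
  map_mul' c c' := by ext; simp

/-- The map `H²(G, A) → H²(G, A')` induced by a homomorphism of coefficients. -/
def H2.map {A' : Type*} [CommGroup A'] (f : A →* A') : H2 G A →* H2 G A' :=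
  QuotientGroup.map _ _ (Z2.map f) (by
    rintro c ⟨d, h1, h2⟩
    refine ⟨f ∘ d, h1.comp f, ?_⟩
    ext p
    simp [Z2.map, h2, coboundary])

variable (G A)

/-- The `2`-torsion subgroup `H²(G, A)[2]`. -/
def H2two : Subgroup (H2 G A) := (powMonoidHom 2 : H2 G A →* H2 G A).ker

variable {G A}

/-- The inflation to `G` of a `2`-cocycle on `Q`, along a continuous morphism from `G` to the
discrete group `Q`. -/
def Z2.infl {Q : Type*} [Group Q] (f : G →* Q) (hf : IsLocallyConstant f) (c : Q × Q → A)
    (hc : IsCocycle c) : Z2 G A :=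
  ⟨fun p => c (f p.1, f p.2),
    ((hf.comp_continuous continuous_fst).prodMk (hf.comp_continuous continuous_snd)).comp c,
    fun x y z => by simpa using hc (f x) (f y) (f z)⟩

end Cohomology

/-! ### The two components of a `2`-torsion class -/

section Components

variable (F : Type*) [Field F]

/-- `P = Fˣ / {±1}`. -/
def P : Type _ := Fˣ ⧸ Subgroup.zpowers (-1 : Fˣ)

instance : CommGroup (P F) := QuotientGroup.Quotient.commGroup _

/-- `P / P²`. -/
def PmodSq : Type _ := P F ⧸ (powMonoidHom 2 : P F →* P F).range

instance : CommGroup (PmodSq F) := QuotientGroup.Quotient.commGroup _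

variable {F} in
/-- The projection `Fˣ → P`. -/
def toP : Fˣ →* P F := QuotientGroup.mk' (Subgroup.zpowers (-1 : Fˣ))

variable {F}

/-- The class in `P / P²` of an element of `Fˣ`. -/
def toPmodSq : Fˣ →* PmodSq F :=
  (QuotientGroup.mk' (powMonoidHom 2 : P F →* P F).range).comp toP

theorem toPmodSq_sq (a : Fˣ) : toPmodSq a * toPmodSq a = 1 := by
  rw [← map_mul]
  refine (QuotientGroup.eq_one_iff _).2 ⟨toP a, ?_⟩
  simp [pow_two]

theorem toPmodSq_neg_one : toPmodSq (-1 : Fˣ) = 1 := by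
  have : toP (-1 : Fˣ) = 1 :=
    (QuotientGroup.eq_one_iff _).2 (Subgroup.mem_zpowers _)
  change QuotientGroup.mk' (powMonoidHom 2 : P F →* P F).range (toP (-1)) = 1
  rw [this, map_one]

/-- The sign map `Fˣ → {±1}` attached to a real embedding of `F`. -/
def signMap (ι : F →+* ℝ) : Fˣ →* ℤˣ where
  toFun x := if 0 < ι x then 1 else -1
  map_one' := by simp
  map_mul' x y := by
    have hx : ι x ≠ 0 := by simp
    have hy : ι y ≠ 0 := by simp
    simp only [Units.val_mul, map_mul]
    rcases lt_or_gt_of_ne hx with hx | hx <;> rcases lt_or_gt_of_ne hy with hy | hy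
    · simp [mul_pos_of_neg_of_neg hx hy, not_lt.2 hx.le, not_lt.2 hy.le]
    · simp [not_lt.2 (mul_neg_of_neg_of_pos hx hy).le, not_lt.2 hx.le, hy]
    · simp [not_lt.2 (mul_neg_of_pos_of_neg hx hy).le, not_lt.2 hy.le, hx]
    · simp [mul_pos hx hy, hx, hy]

variable {G : Type*} [Group G] [TopologicalSpace G] [IsTopologicalGroup G]

/-- The component `γ_±`, represented by the sign of a cocycle. -/
def signComponent (ι : F →+* ℝ) : H2 G Fˣ →* H2 G ℤˣ := H2.map (signMap ι)

/-- A `2`-torsion class is represented by a cocycle `c` with `c² = ∂d`, `d` continuous. -/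
theorem exists_sq_eq_coboundary (γ : H2two G Fˣ) :
    ∃ (c : Z2 G Fˣ) (d : G → Fˣ), H2.mk c = (γ : H2 G Fˣ) ∧ IsLocallyConstant d ∧
      (c : G × G → Fˣ) ^ 2 = coboundary d := by
  obtain ⟨γ, hγ⟩ := γ
  obtain ⟨c, rfl⟩ := QuotientGroup.mk'_surjective _ γ
  have h : (QuotientGroup.mk' (B2 G Fˣ)) (c ^ 2) = 1 := by rw [map_pow]; exact hγ
  obtain ⟨d, h1, h2⟩ := (QuotientGroup.eq_one_iff _).1 h
  exact ⟨c, d, rfl, h1, h2⟩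

/-- The component `γ̄ : σ ↦ d_σ mod {±1}Fˣ²`, where `c² = ∂d` for a cocycle `c` representing `γ`. -/
def barComponent (γ : H2two G Fˣ) : G →* PmodSq F :=
  MonoidHom.mk' (fun σ => toPmodSq ((exists_sq_eq_coboundary γ).choose_spec.choose σ)) (by
    intro σ τ
    obtain ⟨-, -, h⟩ := (exists_sq_eq_coboundary γ).choose_spec.choose_spec
    have h' := congrArg toPmodSq (congrFun h (σ, τ))
    simp only [Pi.pow_apply, pow_two, coboundary, map_mul, map_inv, toPmodSq_sq] at h'
    rw [← map_mul toPmodSq, map_mul toPmodSq]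
    exact (mul_inv_eq_one.1 h'.symm).symm)

/-- Over a compact group and a real field, `barComponent` can be computed from any expression of the
square of any representing cocycle as a coboundary. -/
theorem barComponent_apply [CompactSpace G] (ι : F →+* ℝ) (γ : H2two G Fˣ) (c : Z2 G Fˣ)
    (d : G → Fˣ) (hc : H2.mk c = (γ : H2 G Fˣ)) (hd : IsLocallyConstant d)
    (h : (c : G × G → Fˣ) ^ 2 = coboundary d) (σ : G) :
    barComponent γ σ = toPmodSq (d σ) := by
  change toPmodSq ((exists_sq_eq_coboundary γ).choose_spec.choose σ) = _
  obtain ⟨hc', hd', h'⟩ := (exists_sq_eq_coboundary γ).choose_spec.choose_spec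
  generalize (exists_sq_eq_coboundary γ).choose_spec.choose = d' at *
  generalize (exists_sq_eq_coboundary γ).choose = c' at *
  obtain ⟨e, he, hce⟩ := QuotientGroup.eq.1 (hc.trans hc'.symm)
  -- `d' = d e² χ` with `χ` a continuous character of the compact group `G`
  let χ : G →* Fˣ := MonoidHom.mk' (fun σ => d' σ * (d σ)⁻¹ * (e σ ^ 2)⁻¹) (by
    intro x y
    have h1 := congrFun h (x, y)
    have h2 := congrFun h' (x, y)
    have h3 := congrFun hce (x, y)
    simp only [Pi.pow_apply, coboundary, Subgroup.coe_mul, Subgroup.coe_inv, Pi.mul_apply,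
      Pi.inv_apply] at h1 h2 h3
    have h4 : (c' : G × G → Fˣ) (x, y) = (c : G × G → Fˣ) (x, y) *
      (e x * e y * (e (x * y))⁻¹) := by rw [← h3]; simp
    rw [h4, mul_pow, h1] at h2
    have h5 : d' (x * y) = d' x * d' y * (d' x * d' y * (d' (x * y))⁻¹)⁻¹ := by
      rw [mul_inv, inv_inv, mul_inv_cancel_left]
    rw [h5, ← h2]
    ext
    push_cast
    field_simp)
  have hχ : IsLocallyConstant χ := (hd'.mul hd.inv).mul ((he.comp (· ^ 2)).inv)
  have hfin : (Set.range χ).Finite := hχ.range_finite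
  have hfo : IsOfFinOrder (χ σ) := by
    rw [← MonoidHom.coe_range] at hfin
    have : Finite χ.range := hfin
    exact Submonoid.isOfFinOrder_coe.2 (isOfFinOrder_of_finite (⟨χ σ, σ, rfl⟩ : χ.range))
  have hpm : χ σ = 1 ∨ χ σ = -1 := by
    obtain ⟨m, hm, hm'⟩ := isOfFinOrder_iff_pow_eq_one.1 hfo
    have h1 : |ι (χ σ)| ^ m = 1 := by
      rw [← abs_pow, ← map_pow, ← Units.val_pow_eq_pow_val, hm']; simp
    have h2 := (pow_eq_one_iff_of_nonneg (abs_nonneg _) hm.ne').1 h1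
    rcases eq_or_eq_neg_of_abs_eq h2 with h3 | h3
    · exact Or.inl (Units.ext (ι.injective (by simpa using h3)))
    · exact Or.inr (Units.ext (ι.injective (by simpa using h3)))
  have hχ1 : toPmodSq (χ σ) = 1 := by
    rcases hpm with h | h <;> rw [h]
    · simp
    · exact toPmodSq_neg_one
  have : d' σ = d σ * (e σ * e σ) * χ σ := by
    change _ = _ * _ * (d' σ * (d σ)⁻¹ * (e σ ^ 2)⁻¹)
    ext
    push_cast
    field_simp
  rw [this, map_mul, hχ1, map_mul, map_mul toPmodSq (e σ), toPmodSq_sq]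
  simp

end Components

/-! ### The connecting map -/

section Delta

variable (F B : Type*) [Field F] [DivisionRing B] [Algebra F B]

/-- The inclusion `Fˣ → Bˣ`. -/
abbrev unitsIncl : Fˣ →* Bˣ := Units.map (algebraMap F B).toMonoidHom

instance normal_range_unitsIncl : (unitsIncl F B).range.Normal where
  conj_mem := by
    rintro _ ⟨a, rfl⟩ g
    refine ⟨a, ?_⟩
    rw [eq_mul_inv_iff_mul_eq]
    ext
    exact Algebra.commutes _ _

/-- `Bˣ / Fˣ`. -/
abbrev ProjUnits : Type _ := Bˣ ⧸ (unitsIncl F B).range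

theorem unitsIncl_injective : Function.Injective (unitsIncl F B) :=
  Units.map_injective (algebraMap F B).injective

variable {F B}
variable {G : Type*} [Group G] [TopologicalSpace G] [IsTopologicalGroup G]

/-- For a lift `φ : G → Bˣ` of a morphism `ψ : G → Bˣ / Fˣ`, the product `φ_σ φ_τ φ_{στ}⁻¹` lies
in `Fˣ`. -/
theorem lift_mem (ψ : G →* ProjUnits F B) (φ : G → Bˣ)
    (hφ : ∀ σ, (φ σ : ProjUnits F B) = ψ σ) (p : G × G) :
    ∃ a : Fˣ, unitsIncl F B a = φ p.1 * φ p.2 * (φ (p.1 * p.2))⁻¹ :=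
  (QuotientGroup.eq_one_iff (N := (unitsIncl F B).range) _).1 (by simp [hφ])

/-- The continuous `2`-cocycle `(σ, τ) ↦ φ_σ φ_τ φ_{στ}⁻¹` with values in `Fˣ`, for a continuous
lift `φ` of a morphism `ψ : G → Bˣ / Fˣ`. -/
def liftCocycle (ψ : G →* ProjUnits F B) (φ : G → Bˣ) (hc : IsLocallyConstant φ)
    (hφ : ∀ σ, (φ σ : ProjUnits F B) = ψ σ) : Z2 G Fˣ :=
  ⟨fun p => (lift_mem ψ φ hφ p).choose, by
    have key := fun p => (lift_mem ψ φ hφ p).choose_spec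
    constructor
    · have h1 : IsLocallyConstant (fun p : G × G => φ p.1 * φ p.2 * (φ (p.1 * p.2))⁻¹) :=
        ((hc.comp_continuous continuous_fst).mul (hc.comp_continuous continuous_snd)).mul
          (hc.comp_continuous continuous_mul).inv
      refine IsLocallyConstant.desc _ (unitsIncl F B) ?_ (unitsIncl_injective F B)
      convert h1 using 1
      funext p
      exact key p
    · intro x y z
      apply unitsIncl_injective F B
      have hcomm : ∀ (a : Fˣ) (g : Bˣ), g * unitsIncl F B a = unitsIncl F B a * g := by
        intro a g; ext; exact (Algebra.commutes _ _).symm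
      have h3 := hcomm (lift_mem ψ φ hφ (y, z)).choose
        (φ x * φ (y * z) * (φ (x * (y * z)))⁻¹)
      rw [key (y, z)] at h3
      simp only [map_mul]
      rw [key (x, y), key (x * y, z), key (y, z), key (x, y * z)]
      have h2 := hcomm (lift_mem ψ φ hφ (y, z)).choose (φ x)
      rw [key (y, z)] at h2
      simp only at h2 h3 ⊢
      simp only [← mul_assoc] at h2 ⊢
      rw [← h2]
      simp only [mul_assoc, inv_mul_cancel_left]
      ⟩

theorem liftCocycle_spec (ψ : G →* ProjUnits F B) (φ : G → Bˣ) (hc : IsLocallyConstant φ)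
    (hφ : ∀ σ, (φ σ : ProjUnits F B) = ψ σ) (p : G × G) :
    unitsIncl F B ((liftCocycle ψ φ hc hφ : G × G → Fˣ) p) =
      φ p.1 * φ p.2 * (φ (p.1 * p.2))⁻¹ :=
  (lift_mem ψ φ hφ p).choose_spec

/-- The connecting map `δ`, sending a continuous morphism `ψ : G → Bˣ / Fˣ` to the class of
`(σ, τ) ↦ ψ_σ ψ_τ ψ_{στ}⁻¹`, where `ψ(σ) = ψ_σ Fˣ`. -/
def connecting (ψ : G →* ProjUnits F B) (hψ : IsLocallyConstant ψ) : H2 G Fˣ :=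
  H2.mk (liftCocycle ψ (Quotient.out ∘ ψ) (hψ.comp _) fun _ => Quotient.out_eq' _)

/-- The connecting map does not depend on the lift. -/
theorem connecting_eq (ψ : G →* ProjUnits F B) (hψ : IsLocallyConstant ψ) (φ : G → Bˣ)
    (hc : IsLocallyConstant φ) (hφ : ∀ σ, (φ σ : ProjUnits F B) = ψ σ) :
    connecting ψ hψ = H2.mk (liftCocycle ψ φ hc hφ) := by
  set φ' : G → Bˣ := Quotient.out ∘ ψ with hφ'_def
  have hφ' : ∀ σ, (φ' σ : ProjUnits F B) = ψ σ := fun _ => Quotient.out_eq' _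
  have hex : ∀ σ, ∃ a : Fˣ, unitsIncl F B a = (φ' σ)⁻¹ * φ σ := fun σ =>
    QuotientGroup.eq.1 ((hφ' σ).trans (hφ σ).symm)
  choose d hd using hex
  have hcomm : ∀ (a : Fˣ) (g : Bˣ), g * unitsIncl F B a = unitsIncl F B a * g := by
    intro a g; ext; exact (Algebra.commutes _ _).symm
  have hdc : IsLocallyConstant d := by
    refine IsLocallyConstant.desc _ (unitsIncl F B) ?_ (unitsIncl_injective F B)
    have : unitsIncl F B ∘ d = φ'⁻¹ * φ := by funext σ; exact hd σ
    rw [this]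
    exact (hψ.comp Quotient.out).inv.mul hc
  refine QuotientGroup.eq.2 ⟨d, hdc, ?_⟩
  funext p
  apply unitsIncl_injective F B
  have hd' : ∀ σ, φ σ = unitsIncl F B (d σ) * φ' σ := fun σ => by
    rw [← hcomm, hd]; group
  rw [Subgroup.coe_mul, Subgroup.coe_inv, Pi.mul_apply, Pi.inv_apply, map_mul, map_inv,
    liftCocycle_spec, liftCocycle_spec, inv_mul_eq_iff_eq_mul]
  simp only [coboundary, map_mul, map_inv, hd', mul_inv_rev]
  change _ = φ' p.1 * φ' p.2 * (φ' (p.1 * p.2))⁻¹ * _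
  have e1 := hcomm (d p.2) (φ' p.1)
  have e2 := hcomm (d p.1 * d p.2) (φ' p.1 * φ' p.2 * (φ' (p.1 * p.2))⁻¹)
  rw [map_mul] at e2
  rw [← mul_assoc (φ' p.1 * φ' p.2 * (φ' (p.1 * p.2))⁻¹), e2, mul_assoc _ (φ' p.1),
    ← mul_assoc (φ' p.1) (unitsIncl F B _), e1]
  simp only [mul_assoc]

variable (K : Type*) [Field K]

/-- The absolute Galois group `G_K`, with the Krull topology. -/
abbrev GalK : Type _ := Gal(AlgebraicClosure K/K)

variable (F B)

/-- `Δ_Γ`: the classes in `H²(G_K, Fˣ)[2]` of the form `δ(ψ)` for a continuous morphism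
`ψ : G_K → Bˣ / Fˣ` whose image is isomorphic to `Γ`. -/
def DeltaSet (Γ : Type*) [Group Γ] : Set (H2 (GalK K) Fˣ) :=
  {γ | γ ∈ H2two (GalK K) Fˣ ∧ ∃ (ψ : GalK K →* ProjUnits F B) (hψ : IsLocallyConstant ψ),
    Nonempty (ψ.range ≃* Γ) ∧ connecting ψ hψ = γ}

/-- A quaternion algebra over `F` is totally indefinite if it is split at every real place. -/
def IsTotallyIndefinite : Prop :=
  ∀ v : F →+* ℝ, letI := v.toAlgebra
    Nonempty (TensorProduct F ℝ B ≃ₐ[ℝ] Matrix (Fin 2) (Fin 2) ℝ)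

end Delta

/-! ### The morphisms `(t, a)_P` -/

section Quadratic

variable {K : Type*} [Field K]

/-- The field `K(√t)`, inside the algebraic closure of `K`. -/
def sqrtField (t : Kˣ) : IntermediateField K (AlgebraicClosure K) :=
  IntermediateField.adjoin K {x | x ^ 2 = algebraMap K (AlgebraicClosure K) t}

open Classical in
/-- `(t, a)_P`: the inflation to `G_K` of the morphism sending the non-trivial automorphism of
`K(√t) / K` to the class of `a` (the trivial morphism if `t` is a square). An element of `G_K` is
trivial on `K(√t)` when it fixes the square roots of `t`. -/
def quadMorphism {F : Type*} [Field F] (t : Kˣ) (a : Fˣ) : GalK K →* PmodSq F :=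
  MonoidHom.mk' (fun ρ => if ∀ x ∈ sqrtField t, ρ x = x then 1 else toPmodSq a) (by
    have key : ∀ ρ : GalK K, (∀ x ∈ sqrtField t, ρ x = x) ↔
        ∀ x, x ^ 2 = algebraMap K (AlgebraicClosure K) t → ρ x = x := by
      intro ρ
      refine ⟨fun h x hx => h x (IntermediateField.subset_adjoin _ _ hx), fun h x hx => ?_⟩
      have hle : sqrtField t ≤ IntermediateField.fixedField (Subgroup.zpowers ρ) := by
        refine IntermediateField.adjoin_le_iff.2 fun y hy => ?_
        rintro ⟨g, hg⟩
        have hst : ρ ∈ MulAction.stabilizer (GalK K) y := h y hy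
        exact Subgroup.zpowers_le.2 hst hg
      exact hle hx ⟨ρ, Subgroup.mem_zpowers ρ⟩
    obtain ⟨y, hy⟩ := IsAlgClosed.exists_pow_nat_eq (algebraMap K (AlgebraicClosure K) t)
      (n := 2) (by norm_num)
    have key' : ∀ ρ : GalK K, (∀ x ∈ sqrtField t, ρ x = x) ↔ ρ y = y := by
      intro ρ
      rw [key]
      refine ⟨fun h => h y hy, fun h x hx => ?_⟩
      rcases sq_eq_sq_iff_eq_or_eq_neg.1 (hx.trans hy.symm) with rfl | rfl
      · exact h
      · rw [map_neg, h]
    have hpm : ∀ ρ : GalK K, ρ y = y ∨ ρ y = -y := fun ρ =>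
      sq_eq_sq_iff_eq_or_eq_neg.1 (by rw [← map_pow, hy, AlgEquiv.commutes])
    intro ρ μ
    rw [if_congr (key' (ρ * μ)) rfl rfl, if_congr (key' ρ) rfl rfl, if_congr (key' μ) rfl rfl]
    simp only [AlgEquiv.mul_apply]
    have hsq := toPmodSq_sq a
    by_cases hyy : -y = y
    · have hall : ∀ ρ : GalK K, ρ y = y := fun ρ => by
        rcases hpm ρ with h | h
        · exact h
        · rw [h, hyy]
      simp [hall]
    · rcases hpm ρ with h1 | h1 <;> rcases hpm μ with h2 | h2 <;>
        simp [h1, h2, hyy, hsq])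

end Quadratic

/-! ### Dihedral extensions and the sign cocycle -/

section Dihedral

open DihedralGroup

variable (K : Type*) [Field K] (n : ℕ)

/-- A dihedral extension `M / K` of degree `2n` inside the algebraic closure of `K`, together with
generators `σ`, `τ` presenting its Galois group as
`⟨σ, τ | σⁿ = 1, τ² = 1, στ = τσ⁻¹⟩`; the generators are recorded through an isomorphism with the
dihedral group of order `2n`. -/
structure DihedralExtension where
  M : IntermediateField K (AlgebraicClosure K)
  finiteDimensional : FiniteDimensional K M
  isGalois : IsGalois K M
  iso : DihedralGroup n ≃* Gal(M/K)

attribute [instance] DihedralExtension.finiteDimensional DihedralExtension.isGalois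

variable {K n}

namespace DihedralExtension

variable (E : DihedralExtension K n)

/-- The generator `σ` of order `n`. -/
def σ : Gal(E.M/K) := E.iso (r 1)

/-- The generator `τ` of order `2`. -/
def τ : Gal(E.M/K) := E.iso (sr 0)

theorem σ_pow : E.σ ^ n = 1 := by simp [σ, ← map_pow]

theorem τ_sq : E.τ ^ 2 = 1 := by
  rw [τ, ← map_pow, pow_two, sr_mul_self, map_one]

theorem σ_mul_τ : E.σ * E.τ = E.τ * E.σ⁻¹ := by
  simp [σ, τ, ← map_mul, ← map_inv]

/-- The fixed field `M^H` of a subgroup `H`, inside the algebraic closure of `K`. -/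
def fixed (H : Subgroup Gal(E.M/K)) : IntermediateField K (AlgebraicClosure K) :=
  IntermediateField.lift (IntermediateField.fixedField H)

/-- The projection `G_K → Gal(M/K) ≃ D_{2n}`. -/
def proj : GalK K →* DihedralGroup n :=
  E.iso.symm.toMonoidHom.comp (AlgEquiv.restrictNormalHom E.M)

theorem isLocallyConstant_proj : IsLocallyConstant E.proj := by
  have h : IsLocallyConstant
      (AlgEquiv.restrictNormalHom E.M : GalK K →* Gal(E.M/K)) :=
    (IsLocallyConstant.iff_continuous _).2 (InfiniteGalois.restrictNormalHom_continuous E.M)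
  exact h.comp E.iso.symm

end DihedralExtension

/-- The exponent `0 ≤ i < n` of an element `σ^i τ^j` of the dihedral group, where `σ = r 1`,
`τ = sr 0`, so that `σ^i = r i` and `σ^i τ = sr (-i)`. -/
def expo : DihedralGroup n → ℕ
  | r i => i.val
  | sr i => (-i).val

/-- The sign cocycle on the dihedral group. For `0 ≤ i, i' < n`,
`c(σ^i, σ^i' τ^j') = 1` if `i + i' < n` and `-1` otherwise;
`c(σ^i τ, σ^i' τ^j') = 1` if `i - i' ≥ 0` and `-1` otherwise. -/
def cPM : DihedralGroup n × DihedralGroup n → ℤˣ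
  | (r i, g) => if i.val + expo g < n then 1 else -1
  | (sr i, g) => if expo g ≤ (-i).val then 1 else -1

theorem cPM_pow (hn : 2 < n) (i i' j' : ℕ) (hi : i < n) (hi' : i' < n) (hj' : j' < 2) :
    cPM ((r 1 : DihedralGroup n) ^ i, r 1 ^ i' * sr 0 ^ j') = (if i + i' < n then 1 else -1) ∧
    cPM ((r 1 : DihedralGroup n) ^ i * sr 0, r 1 ^ i' * sr 0 ^ j') =
      (if (i : ℤ) - i' ≥ 0 then 1 else -1) := by
  have : NeZero n := ⟨by omega⟩
  interval_cases j' <;>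
    simp [cPM, expo, ZMod.val_natCast_of_lt hi, ZMod.val_natCast_of_lt hi']

theorem isCocycle_cPM (hn : 2 < n) : IsCocycle (cPM (n := n)) := by
  have : NeZero n := ⟨by omega⟩
  have hlt : ∀ u : ZMod n, u.val < n := fun u => ZMod.val_lt u
  have hadd : ∀ u v : ZMod n, (u + v).val =
      if u.val + v.val < n then u.val + v.val else u.val + v.val - n := by
    intro u v
    split_ifs with h
    · exact ZMod.val_add_of_lt h
    · exact ZMod.val_add_of_le (not_lt.1 h)
  have hsub : ∀ u v : ZMod n, (u - v).val =
      if v.val ≤ u.val then u.val - v.val else u.val + n - v.val := by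
    intro u v
    have h := hadd (u - v) v
    rw [sub_add_cancel] at h
    have h1 := hlt u
    have h2 := hlt v
    have h3 := hlt (u - v)
    split_ifs at h ⊢ <;> omega
  have hneg : ∀ u : ZMod n, ∃ v, u = -v := fun u => ⟨-u, (neg_neg u).symm⟩
  have key : ∀ (p q s t : Prop) [Decidable p] [Decidable q] [Decidable s] [Decidable t],
      ((p ↔ q) ↔ (s ↔ t)) → (if p then (1 : ℤˣ) else -1) * (if q then 1 else -1) =
        (if s then 1 else -1) * (if t then 1 else -1) := by
    intro p q s t _ _ _ _ h
    by_cases hp : p <;> by_cases hq : q <;> by_cases hs : s <;> by_cases ht : t <;>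
      simp_all
  have hex : ∀ x : DihedralGroup n, ∃ u, x = r u ∨ x = sr (-u) := by
    rintro (x | x)
    · exact ⟨x, Or.inl rfl⟩
    · exact ⟨-x, Or.inr (by rw [neg_neg])⟩
  intro x y z
  obtain ⟨u, rfl | rfl⟩ := hex x <;> obtain ⟨v, rfl | rfl⟩ := hex y <;>
    obtain ⟨w, rfl | rfl⟩ := hex z <;>
    simp only [r_mul_r, r_mul_sr, sr_mul_r, sr_mul_sr, cPM, expo, neg_neg, neg_sub,
      sub_neg_eq_add, neg_add_eq_sub] <;>
    apply key <;>
    (have h1 := hlt u; have h2 := hlt v; have h3 := hlt w; simp only [hadd, hsub]) <;>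
    split_ifs <;> omega

/-- The class in `H²(G_K, {±1})` of the inflation of the sign cocycle on `Gal(M/K)`. -/
def DihedralExtension.signClass (E : DihedralExtension K n) (hn : 2 < n) : H2 (GalK K) ℤˣ :=
  H2.mk (Z2.infl E.proj E.isLocallyConstant_proj cPM (isCocycle_cPM hn))

end Dihedral

end BuildingBlock

end

noncomputable section

namespace BuildingBlock

/-! ### A `2`-torsion class is determined by its two components -/

section Components

variable {F : Type*} [Field F]

/-! Since `F` is real, sign splits `Fˣ` as `{±1} × P` with `P` torsion-free. Hence a `2`-torsion
class is determined by its two components (`eq_of_components`), and each component may be computed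
from any convenient lift of `ψ`.

Good generators of a dihedral subgroup of `Bˣ/Fˣ` come from lifts `X`, `Y` of the rotation and a
reflection. Conjugation by `Y` sends `X` to `c X⁻¹` with `c` a scalar, so `z = X²/c` has exact order
`n` and is inverted by `Y`. Everything commuting with `X` and `Y` is scalar, so `z + z⁻¹` lies in
`F`. After replacing `z` by a power, this trace is `t = ζ + ζ⁻¹`. The order of `z` is read off from
`t` by Chebyshev polynomials (`pow_eq_one_iff_eval`), which carries it between `B`, the algebraic
closure and `ℂ`.

Put `x = ±(1 + z)`, `y = Y`, `y² = b`. Then `y x y⁻¹ = α x⁻¹` with `α = 2 + t`, and `xⁿ = a` is a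
scalar with `a² = αⁿ`. The lift `σ^i τ^j ↦ x^i y^j` has a cocycle built from `a`, `α`, `b`, whose
square is the coboundary of `σ^i τ^j ↦ α^i b^j`; this gives `(s, α)_P (t, b)_P`. At the real place
`|t| < 2`, so `α > 0` and `d = t² - 4 < 0`. Indefiniteness then forces `b > 0`, and the sign of `x`
is chosen so that `a < 0`; the sign of the cocycle is thus `cPM`. Finally `i = z - z⁻¹` and `j = y`
present `B` as `(d, b)`.

Conversely, `z = (t + i)/2` and `y = j` in `(d, b)` give such generators. Composing the resulting
embedding with the projection onto `Gal(M/K)` produces a class with the prescribed components, hence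
the given class. -/

theorem toPmodSq_eq_one {a : Fˣ} (h : toPmodSq a = 1) : ∃ h : Fˣ, a = h ^ 2 ∨ a = -h ^ 2 := by
  obtain ⟨q, hq⟩ := (QuotientGroup.eq_one_iff _).1 h
  obtain ⟨u, rfl⟩ := QuotientGroup.mk'_surjective _ q
  obtain ⟨k, hk⟩ := QuotientGroup.eq.1 hq
  refine ⟨u, ?_⟩
  have hk' : a = u ^ 2 * (-1) ^ k := eq_mul_of_inv_mul_eq hk.symm
  rcases Int.even_or_odd k with h | h
  · left; simpa [h.neg_one_zpow] using hk'
  · right; simpa [h.neg_one_zpow] using hk'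

/-- `-1` is not a square in a field with a real embedding, so the second alternative never occurs.
-/
theorem eq_one_or_neg_one_of_sq (ι : F →+* ℝ) {a : Fˣ} (h : a ^ 2 = 1 ∨ a ^ 2 = -1) :
    a = 1 ∨ a = -1 := by
  have h1 : (a : F) ^ 2 = 1 := by
    rcases h with h | h
    · simpa using congrArg Units.val h
    · have h2 : (a : F) ^ 2 = -1 := by simpa using congrArg Units.val h
      have h3 := congrArg ι h2
      simp only [map_pow, map_neg, map_one] at h3
      nlinarith [sq_nonneg (ι a)]
  rcases sq_eq_one_iff.1 h1 with h | h
  · exact Or.inl (Units.ext h)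
  · exact Or.inr (Units.ext (by simpa using h))

theorem signMap_neg_one (ι : F →+* ℝ) : signMap ι (-1) = -1 := by
  simp [signMap]

/-- The inclusion of `{±1}` in `Fˣ`. -/
def signIncl (F : Type*) [Field F] : ℤˣ →* Fˣ := Units.map (Int.castRingHom F).toMonoidHom

theorem signIncl_neg_one : signIncl F (-1) = -1 := by
  ext; simp [signIncl]

theorem coboundary_mul {G A : Type*} [Group G] [CommGroup A] (d e : G → A) :
    coboundary (d * e) = coboundary d * coboundary e := by
  ext p
  simp only [coboundary, Pi.mul_apply, mul_inv, mul_comm, mul_left_comm, mul_assoc]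

theorem map_comp_coboundary {G A A' : Type*} [Group G] [CommGroup A] [CommGroup A'] (f : A →* A')
    (d : G → A) : f ∘ coboundary d = coboundary (f ∘ d) := by
  ext p; simp [coboundary]

variable {G : Type*} [Group G] [TopologicalSpace G]

/-- Write `e = ±h²`. Then `u / ∂h` has square `±1`, so it takes values in `{±1}` and equals its own
sign. The sign of `u` is a coboundary by hypothesis, hence so is `u`. -/
theorem eq_one_of_components (ι : F →+* ℝ) (u : Z2 G Fˣ) (e : G → Fˣ) (he : IsLocallyConstant e)
    (hu : (u : G × G → Fˣ) ^ 2 = coboundary e) (hbar : ∀ σ, toPmodSq (e σ) = 1)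
    (hsign : signComponent ι (H2.mk u) = 1) : H2.mk u = 1 := by
  -- The root is chosen as a function on all of `Fˣ`, so that `root ∘ e` inherits local constancy
  -- from `e`.
  have hroot : ∀ a : Fˣ, ∃ h : Fˣ, toPmodSq a = 1 → a = h ^ 2 ∨ a = -h ^ 2 := by
    intro a
    by_cases ha : toPmodSq a = 1
    · obtain ⟨h, hh⟩ := toPmodSq_eq_one ha
      exact ⟨h, fun _ => hh⟩
    · exact ⟨1, fun h => absurd h ha⟩
  choose root hroot using hroot
  obtain ⟨s, hs, hs'⟩ := (QuotientGroup.eq_one_iff _).1 hsign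
  have hs'' : ∀ p, signMap ι ((u : G × G → Fˣ) p) = coboundary s p := fun p => congrFun hs' p
  set h : G → Fˣ := root ∘ e
  have hh : IsLocallyConstant h := he.comp root
  have hh' : ∀ σ, e σ = h σ ^ 2 ∨ e σ = -h σ ^ 2 := fun σ => hroot _ (hbar σ)
  have hpm : ∀ p, (u : G × G → Fˣ) p * (coboundary h p)⁻¹ = 1 ∨
      (u : G × G → Fˣ) p * (coboundary h p)⁻¹ = -1 := by
    intro p
    apply eq_one_or_neg_one_of_sq ι
    have h1 : (u : G × G → Fˣ) p ^ 2 = e p.1 * e p.2 * (e (p.1 * p.2))⁻¹ := congrFun hu p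
    rw [mul_pow, h1]
    have key : h p.1 ^ 2 * h p.2 ^ 2 * (h (p.1 * p.2) ^ 2)⁻¹ * ((coboundary h p)⁻¹) ^ 2 = 1 := by
      simp only [coboundary]
      ext
      push_cast
      field_simp
    rcases hh' p.1 with h1 | h1 <;> rcases hh' p.2 with h2 | h2 <;>
      rcases hh' (p.1 * p.2) with h3 | h3 <;> rw [h1, h2, h3] <;>
      simp only [inv_neg, neg_mul, mul_neg, neg_neg, key] <;> simp
  have hpm' : ∀ a : Fˣ, a = 1 ∨ a = -1 → a = signIncl F (signMap ι a) := by
    rintro a (rfl | rfl)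
    · simp
    · rw [signMap_neg_one, signIncl_neg_one]
  -- With `sign u = ∂s`, the sign of `u / ∂h` is the coboundary of `s / sign h`; this corrects `h`.
  refine (QuotientGroup.eq_one_iff _).2 ⟨h * (signIncl F ∘ (s * (signMap ι ∘ h)⁻¹)),
    hh.mul ((hs.mul (hh.comp _).inv).comp _), ?_⟩
  rw [coboundary_mul, ← map_comp_coboundary]
  funext p
  have h1 := hpm' _ (hpm p)
  rw [mul_inv_eq_iff_eq_mul, map_mul, map_inv, hs''] at h1
  rw [h1, mul_comm, Pi.mul_apply]
  congr 1
  rw [Function.comp_apply]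
  congr 1
  have h2 := congrFun (map_comp_coboundary (signMap ι) h) p
  rw [Function.comp_apply] at h2
  rw [h2]
  simp only [coboundary, Pi.mul_apply, Pi.inv_apply, mul_inv, Function.comp_apply, inv_inv]
  simp only [mul_comm, mul_left_comm, mul_assoc]

variable [IsTopologicalGroup G]

/-- A `2`-torsion class is determined by its sign and by its image in `Hom(G, P / P²)`. -/
theorem eq_of_components [CompactSpace G] (ι : F →+* ℝ) (γ γ' : H2two G Fˣ)
    (hbar : barComponent γ = barComponent γ')
    (hsign : signComponent ι (γ : H2 G Fˣ) = signComponent ι (γ' : H2 G Fˣ)) : γ = γ' := by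
  obtain ⟨c, d, hc, hd, hcd⟩ := exists_sq_eq_coboundary γ
  obtain ⟨c', d', hc', hd', hcd'⟩ := exists_sq_eq_coboundary γ'
  have key : H2.mk (c / c') = 1 := by
    refine eq_one_of_components ι (c / c') (d * d'⁻¹) (hd.mul hd'.inv) ?_ ?_ ?_
    · have h1 : coboundary (d * d'⁻¹) = coboundary d * (coboundary d')⁻¹ := by
        rw [coboundary_mul]
        congr 1
        funext p; simp [coboundary, mul_comm]
      rw [h1, ← hcd, ← hcd', div_eq_mul_inv]
      funext p
      simp [mul_pow]
    · intro σ
      have h1 := barComponent_apply ι γ c d hc hd hcd σ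
      have h2 := barComponent_apply ι γ' c' d' hc' hd' hcd' σ
      rw [Pi.mul_apply, Pi.inv_apply, map_mul, map_inv, ← h1, ← h2, hbar, mul_inv_cancel]
    · rw [map_div, map_div, hc, hc', hsign, div_self']
  rw [map_div, hc, hc'] at key
  exact Subtype.ext (div_eq_one.1 key)

end Components

/-! ### Galois theory of dihedral extensions -/

section Galois

open DihedralGroup

variable {K : Type*} [Field K] {n : ℕ}

theorem fixes_sqrtField_iff (t : Kˣ) {y : AlgebraicClosure K}
    (hy : y ^ 2 = algebraMap K (AlgebraicClosure K) t) (ρ : GalK K) :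
    (∀ x ∈ sqrtField t, ρ x = x) ↔ ρ y = y := by
  refine ⟨fun h => h y (IntermediateField.subset_adjoin _ _ hy), fun h x hx => ?_⟩
  have hle : sqrtField t ≤ IntermediateField.fixedField (Subgroup.zpowers ρ) := by
    refine IntermediateField.adjoin_le_iff.2 fun z hz => ?_
    have hz' : ρ z = z := by
      rcases sq_eq_sq_iff_eq_or_eq_neg.1 (Eq.trans hz hy.symm) with rfl | rfl
      · exact h
      · rw [map_neg, h]
    rintro ⟨g, hg⟩
    have hst : ρ ∈ MulAction.stabilizer (GalK K) z := hz'
    exact Subgroup.zpowers_le.2 hst hg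
  exact hle hx ⟨ρ, Subgroup.mem_zpowers ρ⟩

theorem quadMorphism_apply {F : Type*} [Field F] (t : Kˣ) (a : Fˣ) (ρ : GalK K)
    [Decidable (∀ x ∈ sqrtField t, ρ x = x)] :
    quadMorphism t a ρ = if ∀ x ∈ sqrtField t, ρ x = x then 1 else toPmodSq a := by
  simp only [quadMorphism, MonoidHom.mk'_apply]
  congr

/-- An element of `G_K` fixes `M^H` if and only if its image in `Gal(M/K)` lies in `H`. -/
theorem DihedralExtension.fixes_fixed_iff (E : DihedralExtension K n) (H : Subgroup Gal(E.M/K))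
    (ρ : GalK K) : (∀ x ∈ E.fixed H, ρ x = x) ↔ E.iso (E.proj ρ) ∈ H := by
  have h1 : E.iso (E.proj ρ) = AlgEquiv.restrictNormalHom E.M ρ := by
    simp [DihedralExtension.proj]
  rw [h1]
  conv_rhs => rw [← IntermediateField.fixingSubgroup_fixedField H]
  rw [IntermediateField.mem_fixingSubgroup_iff]
  have h2 : ∀ x : E.M, ((AlgEquiv.restrictNormalHom E.M ρ x : E.M) : AlgebraicClosure K) = ρ x :=
    fun x => AlgEquiv.restrictNormal_commutes ρ E.M x
  constructor
  · intro h x hx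
    apply Subtype.ext
    rw [h2]
    exact h x ((IntermediateField.mem_lift x).2 hx)
  · intro h x hx
    have hxM : x ∈ E.M := IntermediateField.lift_le _ hx
    have := h ⟨x, hxM⟩ ((IntermediateField.mem_lift (⟨x, hxM⟩ : E.M)).1 hx)
    have h3 := congrArg (fun y : E.M => (y : AlgebraicClosure K)) this
    simp only [h2] at h3
    exact h3

/-- In characteristic zero the algebraic closure is Galois, so a field is recovered from its fixing
subgroup. Equalities of fields thereby become conditions on `proj ρ`. -/
theorem intermediateField_eq_iff [CharZero K] (L L' : IntermediateField K (AlgebraicClosure K)) :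
    L = L' ↔ ∀ ρ : GalK K, (∀ x ∈ L, ρ x = x) ↔ (∀ x ∈ L', ρ x = x) := by
  refine ⟨fun h => by simp [h], fun h => ?_⟩
  have : L.fixingSubgroup = L'.fixingSubgroup := by
    ext ρ
    rw [IntermediateField.mem_fixingSubgroup_iff, IntermediateField.mem_fixingSubgroup_iff]
    exact h ρ
  rw [← InfiniteGalois.fixedField_fixingSubgroup L, this,
    InfiniteGalois.fixedField_fixingSubgroup]

theorem sqrtField_eq_fixed_iff [CharZero K] (E : DihedralExtension K n)
    (H : Subgroup Gal(E.M/K)) (t : Kˣ) :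
    sqrtField t = E.fixed H ↔
      ∀ ρ : GalK K, (∀ x ∈ sqrtField t, ρ x = x) ↔ E.iso (E.proj ρ) ∈ H := by
  rw [intermediateField_eq_iff]
  simp only [E.fixes_fixed_iff]

/-- Quadratic Kummer theory: an open subgroup of index at most two is the group of an extension
`K(√t)`. -/
theorem exists_sqrtField [CharZero K] (χ : GalK K →* ℤˣ) (hχ : IsLocallyConstant χ) :
    ∃ t : Kˣ, ∀ ρ : GalK K, (∀ x ∈ sqrtField t, ρ x = x) ↔ χ ρ = 1 := by
  by_cases htriv : ∀ ρ, χ ρ = 1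
  · refine ⟨1, fun ρ => ?_⟩
    rw [fixes_sqrtField_iff 1 (y := 1) (by simp)]
    simp [htriv]
  push Not at htriv
  obtain ⟨ρ₀, hρ₀⟩ := htriv
  let H : ClosedSubgroup (GalK K) := ⟨χ.ker, (hχ.isClosed_fiber 1)⟩
  have hfix := InfiniteGalois.fixingSubgroup_fixedField H
  have hnot : ρ₀ ∉ (IntermediateField.fixedField H.toSubgroup).fixingSubgroup := by
    rw [hfix]; exact hρ₀
  rw [IntermediateField.mem_fixingSubgroup_iff] at hnot
  push Not at hnot
  obtain ⟨w, hw, hw'⟩ := hnot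
  have hwfix : ∀ ρ, χ ρ = 1 → ρ w = w := fun ρ h => hw ⟨ρ, h⟩
  have hneg : χ ρ₀ = -1 := (Int.units_eq_one_or _).resolve_left hρ₀
  -- This is the projection of `w`, up to a factor, to the part on which `G_K` acts through `χ`; its
  -- square is the required `t`.
  set y := w - ρ₀ w with hy
  have hy0 : y ≠ 0 := sub_ne_zero.2 (Ne.symm hw')
  have hker : ∀ ρ, χ ρ = 1 → ρ y = y := by
    intro ρ h
    have h1 : (ρ₀⁻¹ * ρ * ρ₀) w = w := hwfix _ (by simp [h])
    have h2 : ρ (ρ₀ w) = ρ₀ w := by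
      have := congrArg ρ₀ h1
      simpa [← AlgEquiv.mul_apply, mul_assoc] using this
    rw [hy, map_sub, hwfix ρ h, h2]
  have hyneg : ρ₀ y = -y := by
    have h1 : ρ₀ (ρ₀ w) = w := hwfix (ρ₀ * ρ₀) (by simp [hneg])
    rw [hy, map_sub, h1, neg_sub]
  have hyneg' : ∀ ρ, χ ρ ≠ 1 → ρ y = -y := by
    intro ρ h
    have h1 : (ρ₀⁻¹ * ρ) y = y := hker _ (by
      simp [(Int.units_eq_one_or (χ ρ)).resolve_left h, hneg])
    have h2 := congrArg ρ₀ h1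
    rw [hyneg] at h2
    simpa [← AlgEquiv.mul_apply] using h2
  have hsq : ∀ ρ : GalK K, ρ (y ^ 2) = y ^ 2 := by
    intro ρ
    by_cases h : χ ρ = 1
    · rw [map_pow, hker ρ h]
    · rw [map_pow, hyneg' ρ h, neg_sq]
  obtain ⟨t, ht⟩ := (InfiniteGalois.mem_range_algebraMap_iff_fixed (y ^ 2)).2 hsq
  have ht0 : t ≠ 0 := by
    rintro rfl
    rw [map_zero] at ht
    exact hy0 (pow_eq_zero_iff (two_ne_zero) |>.1 ht.symm)
  refine ⟨Units.mk0 t ht0, fun ρ => ?_⟩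
  rw [fixes_sqrtField_iff _ (y := y) (by simp [ht])]
  refine ⟨fun h => ?_, hker ρ⟩
  by_contra h1
  rw [hyneg' ρ h1] at h
  exact hy0 (self_eq_neg.1 h.symm)

/-- A continuous surjection of `G_K` onto the dihedral group comes from a dihedral extension. -/
theorem exists_dihedralExtension [CharZero K] [NeZero n] (f : GalK K →* DihedralGroup n)
    (hf : IsLocallyConstant f) (hs : Function.Surjective f) :
    ∃ E : DihedralExtension K n, E.proj = f := by
  let H : ClosedSubgroup (GalK K) := ⟨f.ker, hf.isClosed_fiber 1⟩
  have hnorm : H.toSubgroup.Normal := inferInstanceAs f.ker.Normal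
  set M := IntermediateField.fixedField H.toSubgroup with hM
  have hfix : M.fixingSubgroup = f.ker := InfiniteGalois.fixingSubgroup_fixedField H
  have hopen : IsOpen (M.fixingSubgroup : Set (GalK K)) := by
    rw [hfix]; exact hf.isOpen_fiber 1
  have hfd : FiniteDimensional K M := (InfiniteGalois.isOpen_iff_finite M).1 hopen
  have hgal : IsGalois K M := (InfiniteGalois.normal_iff_isGalois M).1 (by
    rw [hfix]; infer_instance)
  have hker : (AlgEquiv.restrictNormalHom M : GalK K →* Gal(M/K)).ker = f.ker := by
    rw [IntermediateField.restrictNormalHom_ker, hfix]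
  have hsurj : Function.Surjective (AlgEquiv.restrictNormalHom M : GalK K →* Gal(M/K)) :=
    AlgEquiv.restrictNormalHom_surjective _
  let e : Gal(M/K) ≃* DihedralGroup n :=
    ((QuotientGroup.quotientKerEquivOfSurjective _ hsurj).symm.trans
      (QuotientGroup.quotientMulEquivOfEq hker)).trans
      (QuotientGroup.quotientKerEquivOfSurjective f hs)
  refine ⟨⟨M, hfd, hgal, e.symm⟩, ?_⟩
  ext ρ
  change e (AlgEquiv.restrictNormalHom M ρ) = f ρ
  have h1 : (QuotientGroup.quotientKerEquivOfSurjective _ hsurj).symm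
      (AlgEquiv.restrictNormalHom M ρ) = (ρ : GalK K ⧸ _) := by
    rw [MulEquiv.symm_apply_eq]; rfl
  simp only [e, MulEquiv.trans_apply, h1]
  rfl

end Galois

/-! ### Dihedral subgroups of `Bˣ / Fˣ` and the attached cocycle -/

section DihedralCocycle

open DihedralGroup

theorem zmod_val_add {n : ℕ} [NeZero n] (u v : ZMod n) :
    (u + v).val = if u.val + v.val < n then u.val + v.val else u.val + v.val - n := by
  split_ifs with h
  · exact ZMod.val_add_of_lt h
  · exact ZMod.val_add_of_le (not_lt.1 h)

theorem zmod_val_sub {n : ℕ} [NeZero n] (u v : ZMod n) :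
    (u - v).val = if v.val ≤ u.val then u.val - v.val else u.val + n - v.val := by
  have h := zmod_val_add (u - v) v
  rw [sub_add_cancel] at h
  have h1 := ZMod.val_lt u
  have h2 := ZMod.val_lt v
  have h3 := ZMod.val_lt (u - v)
  split_ifs at h ⊢ <;> omega

/-- `sr (-u)` is `σ^u τ`, so in both cases `expo` is `u.val`. -/
theorem dihedralGroup_exists_eq {n : ℕ} (g : DihedralGroup n) :
    ∃ u : ZMod n, g = r u ∨ g = sr (-u) := by
  rcases g with u | u
  · exact ⟨u, Or.inl rfl⟩
  · exact ⟨-u, Or.inr (by rw [neg_neg])⟩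

variable {F B : Type*} [Field F] [DivisionRing B] [Algebra F B] {n : ℕ}

theorem unitsIncl_commute (a : Fˣ) (g : Bˣ) : Commute (unitsIncl F B a) g := by
  ext; exact Algebra.commutes _ _

/-- Conjugation by `y` sends `x` to `α x⁻¹`, with `α` central; take `k`-th powers. -/
theorem conj_pow_eq {x y : Bˣ} {α : Fˣ} (h : y * x = unitsIncl F B α * (x⁻¹ * y)) (k : ℕ) :
    y * x ^ k = unitsIncl F B (α ^ k) * ((x ^ k)⁻¹ * y) := by
  have h1 : y * x * y⁻¹ = unitsIncl F B α * x⁻¹ := by rw [h]; group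
  have h2 : y * x ^ k * y⁻¹ = (unitsIncl F B α * x⁻¹) ^ k := by rw [← h1, conj_pow]
  rw [(unitsIncl_commute α x⁻¹).mul_pow, mul_inv_eq_iff_eq_mul] at h2
  rw [h2, map_pow, inv_pow, mul_assoc]

/-- Conjugation by `y` fixes the scalar `c`, but also sends it to `α^k c⁻¹`. -/
theorem sq_eq_of_pow_eq {x y : Bˣ} {α : Fˣ} (h : y * x = unitsIncl F B α * (x⁻¹ * y)) {k : ℕ}
    {c : Fˣ} (hc : x ^ k = unitsIncl F B c) : c ^ 2 = α ^ k := by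
  apply unitsIncl_injective F B
  have h1 := conj_pow_eq h k
  rw [hc, ← (unitsIncl_commute c y).eq, ← mul_assoc, mul_left_inj, ← mul_inv_eq_one] at h1
  rw [map_pow, pow_two, ← mul_inv_eq_one, ← h1]
  simp only [← map_mul, ← map_inv]
  congr 1
  ext; push_cast; field_simp

variable (n) in
/-- Units `x`, `y` of `B` whose classes generate a dihedral subgroup of order `2n` of `Bˣ / Fˣ`. -/
structure IsDihedralPair (x y : Bˣ) (α b a : Fˣ) : Prop where
  conj : y * x = unitsIncl F B α * (x⁻¹ * y)
  pow : x ^ n = unitsIncl F B a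
  sq : y * y = unitsIncl F B b
  dvd : ∀ m : ℕ, x ^ m ∈ (unitsIncl F B).range → n ∣ m

/-- The lift `σ^i τ^j ↦ x^i y^j` for `0 ≤ i < n`. -/
def dihedralLift (x y : Bˣ) : DihedralGroup n → Bˣ
  | r i => x ^ i.val
  | sr i => x ^ (-i).val * y

/-- The `2`-cocycle attached to the lift `σ^i τ^j ↦ x^i y^j`. -/
def dihedralCocycle (α b a : Fˣ) : DihedralGroup n × DihedralGroup n → Fˣ
  | (r i, g) => if i.val + expo g < n then 1 else a
  | (sr i, r j) => (if j.val ≤ (-i).val then 1 else a⁻¹) * α ^ j.val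
  | (sr i, sr j) => (if (-j).val ≤ (-i).val then 1 else a⁻¹) * (α ^ (-j).val * b)

/-- The map `σ^i τ^j ↦ α^i b^j` for `0 ≤ i < n`. -/
def dihedralNorm (α b : Fˣ) : DihedralGroup n → Fˣ
  | r i => α ^ i.val
  | sr i => α ^ (-i).val * b

namespace IsDihedralPair

variable {x y : Bˣ} {α b a : Fˣ}

/-- Moving `y` past `x^v` costs `α^v` and turns a sum of exponents into a difference. Bringing the
exponent back to `[0, n)` costs `a` or `a⁻¹`. -/
theorem lift_mul [NeZero n] (h : IsDihedralPair n x y α b a) (g g' : DihedralGroup n) :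
    dihedralLift x y g * dihedralLift x y g' =
      unitsIncl F B (dihedralCocycle α b a (g, g')) * dihedralLift x y (g * g') := by
  have hadd : ∀ u v : ZMod n, x ^ u.val * x ^ v.val =
      unitsIncl F B (if u.val + v.val < n then 1 else a) * x ^ (u + v).val := by
    intro u v
    rw [zmod_val_add, ← pow_add]
    split_ifs with hlt
    · simp
    · rw [← h.pow, ← pow_add, Nat.add_sub_cancel' (not_lt.1 hlt)]
  have hsub : ∀ u v : ZMod n, x ^ u.val * (x ^ v.val)⁻¹ =
      unitsIncl F B (if v.val ≤ u.val then 1 else a⁻¹) * x ^ (u - v).val := by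
    intro u v
    have hv := ZMod.val_lt v
    rw [zmod_val_sub, mul_inv_eq_iff_eq_mul, mul_assoc, ← pow_add]
    split_ifs with hlt
    · rw [Nat.sub_add_cancel hlt]; simp
    · rw [Nat.sub_add_cancel (by omega), pow_add, map_inv, ← h.pow]
      rw [← pow_add, add_comm, pow_add, inv_mul_cancel_left]
  have hmid : ∀ u v : ZMod n, x ^ u.val * y * x ^ v.val =
      unitsIncl F B ((if v.val ≤ u.val then 1 else a⁻¹) * α ^ v.val) * (x ^ (u - v).val * y) := by
    intro u v
    rw [mul_assoc, conj_pow_eq h.conj, map_mul, ← mul_assoc, ← (unitsIncl_commute _ (x ^ u.val)).eq,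
      mul_assoc, ← mul_assoc (x ^ u.val), hsub]
    simp only [← mul_assoc]
    rw [(unitsIncl_commute _ (unitsIncl F B _)).eq]
  obtain ⟨u, rfl | rfl⟩ := dihedralGroup_exists_eq g <;>
    obtain ⟨v, rfl | rfl⟩ := dihedralGroup_exists_eq g' <;>
    simp only [r_mul_r, r_mul_sr, sr_mul_r, sr_mul_sr, dihedralLift, dihedralCocycle, expo,
      neg_neg, neg_sub, sub_neg_eq_add, neg_add_eq_sub]
  · exact hadd u v
  · rw [← mul_assoc, hadd, mul_assoc]
  · rw [hmid]
  · rw [← mul_assoc, hmid, mul_assoc, mul_assoc, h.sq, ← (unitsIncl_commute _ _).eq, ← mul_assoc,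
      ← map_mul, mul_assoc]

/-- By `sq_eq_of_pow_eq`, `a² = αⁿ`: the square of each carry is exactly the power of `α` lost when
the exponent is reduced modulo `n`. -/
theorem cocycle_sq [NeZero n] (h : IsDihedralPair n x y α b a) :
    (dihedralCocycle α b a : DihedralGroup n × DihedralGroup n → Fˣ) ^ 2 =
      coboundary (dihedralNorm α b) := by
  funext ⟨g, g'⟩
  have hadd : ∀ u v : ZMod n, (if u.val + v.val < n then 1 else a) ^ 2 * α ^ (u + v).val =
      α ^ u.val * α ^ v.val := by
    intro u v
    rw [zmod_val_add, ← pow_add]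
    split_ifs with hlt
    · simp
    · rw [sq_eq_of_pow_eq h.conj h.pow, ← pow_add, Nat.add_sub_cancel' (not_lt.1 hlt)]
  have hsub : ∀ u v : ZMod n, ((if v.val ≤ u.val then 1 else a⁻¹) * α ^ v.val) ^ 2 *
      α ^ (u - v).val = α ^ u.val * α ^ v.val := by
    intro u v
    have hv := ZMod.val_lt v
    rw [zmod_val_sub, mul_pow, mul_assoc, ← pow_mul, ← pow_add, ← pow_add]
    split_ifs with hlt
    · rw [one_pow, one_mul]; congr 1; omega
    · rw [inv_pow, sq_eq_of_pow_eq h.conj h.pow, inv_mul_eq_iff_eq_mul, ← pow_add]; congr 1; omega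
  rw [Pi.pow_apply, coboundary, eq_mul_inv_iff_mul_eq]
  obtain ⟨u, rfl | rfl⟩ := dihedralGroup_exists_eq g <;>
    obtain ⟨v, rfl | rfl⟩ := dihedralGroup_exists_eq g' <;>
    simp only [r_mul_r, r_mul_sr, sr_mul_r, sr_mul_sr, dihedralNorm, dihedralCocycle, expo,
      neg_neg, neg_sub, sub_neg_eq_add, neg_add_eq_sub]
  · exact hadd u v
  · rw [← mul_assoc, hadd, mul_assoc]
  · rw [← mul_assoc, hsub, mul_right_comm]
  · rw [← mul_assoc, mul_pow, mul_right_comm, hsub, pow_two]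
    simp only [mul_comm, mul_left_comm, mul_assoc]

theorem sign_cocycle (ι : F →+* ℝ) (hα : 0 < ι α) (hb : 0 < ι b) (ha : ι a < 0)
    (p : DihedralGroup n × DihedralGroup n) : signMap ι (dihedralCocycle α b a p) = cPM p := by
  have h1 : signMap ι α = 1 := by simp [signMap, hα]
  have h2 : signMap ι b = 1 := by simp [signMap, hb]
  have h3 : signMap ι a = -1 := by simp [signMap, ha.le]
  -- The `Decidable` instances are kept arbitrary to match both definitions.
  have key : ∀ (q : Prop) (i₁ i₂ : Decidable q),
      signMap ι (@ite _ q i₁ 1 a) = @ite _ q i₂ 1 (-1) := by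
    intro q _ _
    by_cases hq : q <;> simp [hq, h3]
  have key' : ∀ (q : Prop) (i₁ i₂ : Decidable q),
      signMap ι (@ite _ q i₁ 1 a⁻¹) = @ite _ q i₂ 1 (-1) := by
    intro q _ _
    by_cases hq : q <;> simp [hq, h3]
  obtain ⟨_ | _, _ | _⟩ := p
  · exact key _ _ _
  · exact key _ _ _
  · change signMap ι (_ * _) = _
    rw [map_mul, map_pow, h1, one_pow, mul_one]
    exact key' _ _ _
  · change signMap ι (_ * (_ * _)) = _
    rw [map_mul, map_mul, map_pow, h1, h2, one_pow, mul_one, mul_one]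
    exact key' _ _ _

/-- The embedding of the dihedral group in `Bˣ / Fˣ`. -/
def hom [NeZero n] (h : IsDihedralPair n x y α b a) : DihedralGroup n →* ProjUnits F B :=
  MonoidHom.mk' (fun g => (dihedralLift x y g : ProjUnits F B)) (by
    intro g g'
    rw [← QuotientGroup.mk_mul, h.lift_mul]
    refine (QuotientGroup.eq.2 ⟨dihedralCocycle α b a (g, g'), ?_⟩)
    rw [(unitsIncl_commute _ _).eq, inv_mul_cancel_left])

/-- If some `x^i y` were scalar, `y` would commute with `x`; then `x² = α` would be scalar and `n ∣
2`. -/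
theorem hom_injective [NeZero n] (hn : 2 < n) (h : IsDihedralPair n x y α b a) :
    Function.Injective h.hom := by
  rw [injective_iff_map_eq_one]
  intro g hg
  have hg' : dihedralLift x y g ∈ (unitsIncl F B).range := (QuotientGroup.eq_one_iff _).1 hg
  rcases g with u | u
  · have h1 := h.dvd _ hg'
    have h2 := Nat.eq_zero_of_dvd_of_lt h1 (ZMod.val_lt u)
    rw [(ZMod.val_eq_zero u).1 h2, r_zero]
  · exfalso
    obtain ⟨c, hc⟩ := hg'
    have hy : y = (x ^ (-u).val)⁻¹ * unitsIncl F B c := by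
      rw [hc, dihedralLift]; group
    have hcomm : y * x = x * y := by
      rw [hy, mul_assoc, (unitsIncl_commute c x).eq, ← mul_assoc, ← mul_assoc]
      congr 1
      exact ((Commute.refl x).pow_right _).inv_right.symm.eq
    have h2 : n ∣ 2 := h.dvd 2 ⟨α, by
      have := h.conj
      rw [hcomm, ← mul_assoc, mul_left_inj, eq_mul_inv_iff_mul_eq] at this
      rw [pow_two, this]⟩
    exact absurd (Nat.le_of_dvd (by norm_num) h2) (by omega)

variable {G : Type*} [Group G] [TopologicalSpace G] [IsTopologicalGroup G]

/-- The class attached to a dihedral quotient of `G` is `2`-torsion, and both its components are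
explicit. -/
theorem components [CompactSpace G] [NeZero n] (hn : 2 < n) (h : IsDihedralPair n x y α b a)
    (ι : F →+* ℝ) (hα : 0 < ι α) (hb : 0 < ι b) (ha : ι a < 0) (f : G →* DihedralGroup n)
    (hf : IsLocallyConstant f) :
    ∃ hγ : connecting (h.hom.comp f) (hf.comp h.hom) ∈ H2two G Fˣ,
      (∀ ρ, barComponent ⟨_, hγ⟩ ρ = toPmodSq (dihedralNorm α b (f ρ))) ∧
      signComponent ι (connecting (h.hom.comp f) (hf.comp h.hom)) =
        H2.mk (Z2.infl f hf cPM (isCocycle_cPM hn)) := by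
  have hlift : ∀ ρ, ((dihedralLift x y (f ρ) : Bˣ) : ProjUnits F B) = (h.hom.comp f) ρ :=
    fun _ => rfl
  -- The class is independent of the lift, so the dihedral one may be used; its cocycle is the
  -- inflation of `dihedralCocycle`.
  rw [connecting_eq (h.hom.comp f) (hf.comp h.hom) (dihedralLift x y ∘ f) (hf.comp _) hlift]
  set c := liftCocycle (h.hom.comp f) (dihedralLift x y ∘ f) (hf.comp _) hlift
  have hc : ∀ p : G × G, (c : G × G → Fˣ) p = dihedralCocycle α b a (f p.1, f p.2) := by
    intro p
    apply unitsIncl_injective F B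
    rw [liftCocycle_spec]
    simp only [Function.comp_apply]
    rw [h.lift_mul, map_mul, mul_inv_cancel_right]
  have hsq : (c : G × G → Fˣ) ^ 2 = coboundary (dihedralNorm α b ∘ f) := by
    funext p
    have h1 := congrFun h.cocycle_sq (f p.1, f p.2)
    rw [Pi.pow_apply, hc]
    simpa [coboundary] using h1
  have hd : IsLocallyConstant (dihedralNorm α b ∘ f) := hf.comp _
  have hmem : H2.mk c ∈ H2two G Fˣ := by
    change H2.mk c ^ 2 = 1
    rw [← map_pow]
    exact (QuotientGroup.eq_one_iff _).2 ⟨_, hd, hsq⟩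
  refine ⟨hmem, fun ρ => barComponent_apply ι ⟨_, hmem⟩ c _ rfl hd hsq ρ, ?_⟩
  change H2.mk (Z2.map (signMap ι) c) = _
  congr 1
  ext p : 2
  change signMap ι ((c : G × G → Fˣ) p) = cPM (f p.1, f p.2)
  rw [hc, sign_cocycle ι hα hb ha]

end IsDihedralPair

/-- For odd `n` the sign cocycle is a coboundary. -/
theorem cPM_eq_coboundary [NeZero n] (hn : Odd n) :
    (cPM : DihedralGroup n × DihedralGroup n → ℤˣ) =
      coboundary (fun g => (-1 : ℤˣ) ^ expo g) := by
  funext ⟨g, g'⟩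
  rw [coboundary, eq_mul_inv_iff_mul_eq]
  -- For odd `n`, reducing an exponent by `n` flips its parity, and `cPM` is `-1` exactly when such
  -- a reduction occurs.
  have hpow : ∀ m : ℕ, (-1 : ℤˣ) ^ (m + n) = (-1) * (-1) ^ m := by
    intro m; rw [pow_add, hn.neg_one_pow, mul_comm]
  have hadd : ∀ u v : ZMod n, (if u.val + v.val < n then (1 : ℤˣ) else -1) *
      (-1) ^ (u + v).val = (-1) ^ u.val * (-1) ^ v.val := by
    intro u v
    rw [zmod_val_add, ← pow_add]
    split_ifs with hlt
    · simp
    · rw [← hpow, Nat.sub_add_cancel (not_lt.1 hlt)]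
  have hsub : ∀ u v : ZMod n, (if v.val ≤ u.val then (1 : ℤˣ) else -1) *
      (-1) ^ (u - v).val = (-1) ^ u.val * (-1) ^ v.val := by
    intro u v
    have hv := ZMod.val_lt v
    have h2 : (-1 : ℤˣ) ^ v.val * (-1) ^ v.val = 1 := by
      rw [← pow_add, Even.neg_one_pow ⟨_, rfl⟩]
    rw [zmod_val_sub, ← mul_left_inj ((-1 : ℤˣ) ^ v.val), mul_assoc, mul_assoc, h2, mul_one,
      ← pow_add]
    split_ifs with hlt
    · rw [Nat.sub_add_cancel hlt, one_mul]
    · rw [Nat.sub_add_cancel (by omega), hpow]; simp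
  obtain ⟨u, rfl | rfl⟩ := dihedralGroup_exists_eq g <;>
    obtain ⟨v, rfl | rfl⟩ := dihedralGroup_exists_eq g' <;>
    simp only [r_mul_r, r_mul_sr, sr_mul_r, sr_mul_sr, cPM, expo,
      neg_neg, neg_sub, sub_neg_eq_add, neg_add_eq_sub]
  · exact hadd u v
  · exact hadd u v
  · exact hsub u v
  · exact hsub u v

theorem DihedralExtension.signClass_eq_one {K : Type*} [Field K] (E : DihedralExtension K n)
    (hn : 2 < n) (hodd : Odd n) : E.signClass hn = 1 := by
  have : NeZero n := ⟨by omega⟩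
  refine (QuotientGroup.eq_one_iff _).2 ⟨(fun g => (-1 : ℤˣ) ^ expo g) ∘ E.proj,
    E.isLocallyConstant_proj.comp _, ?_⟩
  funext p
  have h1 := congrFun (cPM_eq_coboundary hodd) (E.proj p.1, E.proj p.2)
  change cPM (E.proj p.1, E.proj p.2) = _
  rw [h1]
  simp [coboundary]

end DihedralCocycle

/-! ### Traces of roots of unity -/

section Trace

open Polynomial

variable {F : Type*} [Field F]

/-- If `z + z⁻¹ = t`, then `z^k + z^{-k}` is the value at `t` of a rescaled Chebyshev polynomial. -/
theorem pow_add_inv_pow {A : Type*} [Ring A] [Algebra F A] {z : Aˣ} {t : F}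
    (h : (z : A) + (z⁻¹ : Aˣ) = algebraMap F A t) (k : ℕ) :
    ((z ^ k : Aˣ) : A) + ((z ^ k)⁻¹ : Aˣ) = algebraMap F A ((Chebyshev.C F k).eval t) := by
  induction k using Nat.twoStepInduction with
  | zero => simp [one_add_one_eq_two, map_ofNat]
  | one => simpa using h
  | more k h1 h2 =>
    have h3 : Chebyshev.C F ((k + 2 : ℕ) : ℤ) =
        X * Chebyshev.C F ((k + 1 : ℕ) : ℤ) - Chebyshev.C F (k : ℤ) := by
      exact_mod_cast Chebyshev.C_add_two F k
    rw [h3, eval_sub, eval_mul, eval_X, map_sub, map_mul, ← h1, ← h2, ← h]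
    have e1 : z * z ^ (k + 1) = z ^ (k + 2) := by rw [← pow_succ']
    have e2 : z * (z ^ (k + 1))⁻¹ = (z ^ k)⁻¹ := by rw [pow_succ]; group
    have e3 : z⁻¹ * z ^ (k + 1) = z ^ k := by rw [pow_succ']; group
    have e4 : z⁻¹ * (z ^ (k + 1))⁻¹ = (z ^ (k + 2))⁻¹ := by
      rw [← mul_inv_rev, ← pow_succ]
    rw [add_mul, mul_add, mul_add]
    simp only [← Units.val_mul, e1, e2, e3, e4]
    abel

/-- If `w + w⁻¹ = 2` then `(w - 1)² = 0`, so `w = 1` in a division ring. The criterion depends on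
`t` alone, not on `A`. -/
theorem pow_eq_one_iff_eval {A : Type*} [DivisionRing A] [Algebra F A] {z : Aˣ} {t : F}
    (h : (z : A) + (z⁻¹ : Aˣ) = algebraMap F A t) (m : ℕ) :
    z ^ m = 1 ↔ (Chebyshev.C F m).eval t = 2 := by
  have h1 := pow_add_inv_pow h m
  constructor
  · intro h2
    rw [h2] at h1
    apply (algebraMap F A).injective
    rw [← h1]
    simp [one_add_one_eq_two, map_ofNat]
  · intro h2
    rw [h2] at h1
    set w := z ^ m
    have h3 : ((w : A) - 1) * ((w : A) - 1) = 0 := by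
      have h4 : (w : A) * ((w : A) + (w⁻¹ : Aˣ)) = w * 2 := by rw [h1, map_ofNat]
      rw [mul_add, Units.mul_inv] at h4
      rw [sub_mul, mul_sub, one_mul, mul_one, sub_sub_eq_add_sub,
        sub_add_eq_add_sub, h4]
      rw [mul_two]; abel
    exact Units.ext (sub_eq_zero.1 (mul_self_eq_zero.1 h3))

theorem exists_add_inv_eq (A : Type*) [Field A] [IsAlgClosed A] [CharZero A] (t : A) :
    ∃ z : Aˣ, (z : A) + (z⁻¹ : Aˣ) = t := by
  obtain ⟨s, hs⟩ := IsAlgClosed.exists_pow_nat_eq (t ^ 2 - 4) (n := 2) (by norm_num)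
  have h : (t + s) / 2 * ((t - s) / 2) = 1 := by
    field_simp
    linear_combination -hs
  refine ⟨⟨(t + s) / 2, (t - s) / 2, h, by rw [mul_comm, h]⟩, ?_⟩
  simp only [Units.inv_mk]
  ring

variable {n : ℕ} {t : F}

/-- The trace of a primitive `n`-th root of unity, `n > 2`, lies strictly between `-2` and `2`. -/
theorem trace_bounds (ι : F →+* ℝ) (hn : 2 < n)
    (ht : ∀ m : ℕ, (Chebyshev.C F m).eval t = 2 ↔ n ∣ m) : -2 < ι t ∧ ι t < 2 := by
  -- A complex `z` of trace `ι t` is an `n`-th root of unity by the Chebyshev criterion. So `ι t = 2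
  -- Re z`, and `z² ≠ 1` makes `Im z` nonzero.
  let : Algebra F ℂ := ((algebraMap ℝ ℂ).comp ι).toAlgebra
  have halg : algebraMap F ℂ t = (ι t : ℂ) := rfl
  obtain ⟨z, hz⟩ := exists_add_inv_eq ℂ (algebraMap F ℂ t)
  have hz1 : z ^ n = 1 := (pow_eq_one_iff_eval hz n).2 ((ht n).2 dvd_rfl)
  have hz2 : z ^ 2 ≠ 1 := fun h => by
    have := Nat.le_of_dvd (by norm_num) ((ht 2).1 ((pow_eq_one_iff_eval hz 2).1 h))
    omega
  have hnorm : ‖(z : ℂ)‖ = 1 := Complex.norm_eq_one_of_pow_eq_one (n := n)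
    (by rw [← Units.val_pow_eq_pow_val, hz1, Units.val_one]) (by omega)
  have hinv : ((z⁻¹ : ℂˣ) : ℂ) = (starRingEnd ℂ) z := by
    rw [Units.val_inv_eq_inv_val, Complex.inv_def, Complex.normSq_eq_norm_sq, hnorm]
    simp
  have hre : ι t = 2 * (z : ℂ).re := by
    rw [hinv, Complex.add_conj, halg] at hz
    exact_mod_cast hz.symm
  have hsq : (z : ℂ).re * (z : ℂ).re + (z : ℂ).im * (z : ℂ).im = 1 := by
    rw [← Complex.normSq_apply, Complex.normSq_eq_norm_sq, hnorm, one_pow]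
  have him : (z : ℂ).im ≠ 0 := by
    intro h0
    apply hz2
    apply Units.ext
    rw [h0, mul_zero, add_zero] at hsq
    rw [Units.val_pow_eq_pow_val, pow_two]
    apply Complex.ext <;> simp [h0, hsq]
  have hpos : 0 < (z : ℂ).im * (z : ℂ).im := mul_self_pos.2 him
  constructor <;> nlinarith

end Trace

/-! ### Generators of a quaternion algebra with a dihedral relation -/

section Quaternion

open Polynomial

variable {F B : Type*} [Field F] [DivisionRing B] [Algebra F B]

/-- If `y` commuted with `x`, then `x² = c` would be scalar. Hence `x` is not scalar, and in a
relation `p + q y = 0` with `p, q` in `F + F x`, a nonzero `q` would make `y = -q⁻¹ p` commute with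
`x`. -/
theorem linearIndependent_of_conj {x y : Bˣ} {c : Fˣ}
    (h : y * x = unitsIncl F B c * (x⁻¹ * y)) (hx : x ^ 2 ∉ (unitsIncl F B).range) :
    LinearIndependent F ![(1 : B), x, y, x * y] := by
  have hncomm : ¬ Commute (y : B) x := by
    intro hc
    have hc' : y * x = x * y := Units.ext hc.eq
    apply hx
    refine ⟨c, ?_⟩
    rw [hc', ← mul_assoc, mul_left_inj, eq_mul_inv_iff_mul_eq] at h
    rw [pow_two, h]
  have hxF : ∀ a : F, (x : B) ≠ algebraMap F B a := by
    intro a ha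
    apply hncomm
    rw [ha]
    exact (Algebra.commutes a (y : B)).symm
  have hcx : ∀ a b : F, Commute (algebraMap F B a + algebraMap F B b * x) x := fun a b =>
    (Algebra.commute_algebraMap_left a _).add_left
      ((Algebra.commute_algebraMap_left b _).mul_left (Commute.refl _))
  have hzero : ∀ a b : F, algebraMap F B a + algebraMap F B b * x = 0 → a = 0 ∧ b = 0 := by
    intro a b hab
    have hb : b = 0 := by
      by_contra hb
      apply hxF (-(b⁻¹ * a))
      have hb' : algebraMap F B b ≠ 0 := by simpa using hb
      have e : algebraMap F B b * x = -algebraMap F B a := by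
        rw [eq_neg_iff_add_eq_zero, add_comm]; exact hab
      rw [map_neg, map_mul, map_inv₀, ← mul_neg, ← e, inv_mul_cancel_left₀ hb']
    subst hb
    simpa using hab
  rw [Fintype.linearIndependent_iff]
  intro g hg
  simp only [Fin.sum_univ_four, Matrix.cons_val, Algebra.smul_def, mul_one] at hg
  rw [← mul_assoc, add_assoc, ← add_mul] at hg
  have h2 : algebraMap F B (g 2) + algebraMap F B (g 3) * x = 0 := by
    by_contra h2
    apply hncomm
    have hy : (y : B) = (algebraMap F B (g 2) + algebraMap F B (g 3) * x)⁻¹ *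
        -(algebraMap F B (g 0) + algebraMap F B (g 1) * x) := by
      rw [eq_inv_mul_iff_mul_eq₀ h2, eq_neg_iff_add_eq_zero, add_comm]
      exact hg
    rw [hy]
    exact ((hcx _ _).inv_left₀).mul_left (hcx _ _).neg_left
  rw [h2, zero_mul, add_zero] at hg
  obtain ⟨h3, h4⟩ := hzero _ _ h2
  obtain ⟨h5, h6⟩ := hzero _ _ hg
  intro i
  fin_cases i <;> assumption

theorem subalgebra_eq_top_of_conj (hB : Module.finrank F B = 4) {x y : Bˣ} {c : Fˣ}
    (h : y * x = unitsIncl F B c * (x⁻¹ * y)) (hx : x ^ 2 ∉ (unitsIncl F B).range)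
    (S : Subalgebra F B) (hxS : (x : B) ∈ S) (hyS : (y : B) ∈ S) : S = ⊤ := by
  have h1 := (linearIndependent_of_conj h hx).span_eq_top_of_card_eq_finrank (by simp [hB])
  rw [← Algebra.toSubmodule_eq_top, eq_top_iff, ← h1, Submodule.span_le]
  rintro _ ⟨i, rfl⟩
  fin_cases i
  · exact S.one_mem
  · exact hxS
  · exact hyS
  · exact S.mul_mem hxS hyS

/-- An element commuting with the two generators is a scalar. -/
theorem mem_range_of_commute [Algebra.IsCentral F B] (hB : Module.finrank F B = 4) {x y : Bˣ}
    {c : Fˣ} (h : y * x = unitsIncl F B c * (x⁻¹ * y)) (hx : x ^ 2 ∉ (unitsIncl F B).range) {z : B}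
    (hzx : Commute z x) (hzy : Commute z y) : ∃ a : F, algebraMap F B a = z := by
  have h1 := subalgebra_eq_top_of_conj hB h hx (Subalgebra.centralizer F {z})
    (by rw [Subalgebra.mem_centralizer_iff]; rintro _ rfl; exact hzx.eq)
    (by rw [Subalgebra.mem_centralizer_iff]; rintro _ rfl; exact hzy.eq)
  have h2 : z ∈ Subalgebra.center F B := by
    rw [Subalgebra.mem_center_iff]
    intro w
    have hw : w ∈ Subalgebra.centralizer F {z} := h1 ▸ Algebra.mem_top
    exact ((Subalgebra.mem_centralizer_iff F).1 hw z rfl).symm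
  rw [Algebra.IsCentral.center_eq_bot] at h2
  exact Algebra.mem_bot.1 h2

theorem mem_range_unitsIncl_of_commute [Algebra.IsCentral F B] (hB : Module.finrank F B = 4)
    {x y : Bˣ} {c : Fˣ} (h : y * x = unitsIncl F B c * (x⁻¹ * y))
    (hx : x ^ 2 ∉ (unitsIncl F B).range) {z : Bˣ} (hzx : Commute z x) (hzy : Commute z y) :
    z ∈ (unitsIncl F B).range := by
  obtain ⟨a, ha⟩ := mem_range_of_commute hB h hx (hzx.map (Units.coeHom B))
    (hzy.map (Units.coeHom B))
  have ha0 : a ≠ 0 := by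
    rintro rfl
    exact z.ne_zero (by simpa using ha.symm)
  exact ⟨Units.mk0 a ha0, Units.ext ha⟩

/-- If `x` and `y` satisfy the dihedral relation with multiplier `c`, then `x^m` is a scalar if and
only if `x^{2m} = c^m`. -/
theorem pow_mem_range_iff [Algebra.IsCentral F B] (hB : Module.finrank F B = 4)
    {x y : Bˣ} {c : Fˣ} (h : y * x = unitsIncl F B c * (x⁻¹ * y))
    (hx : x ^ 2 ∉ (unitsIncl F B).range) (m : ℕ) :
    x ^ m ∈ (unitsIncl F B).range ↔ (x ^ 2) ^ m = unitsIncl F B (c ^ m) := by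
  rw [← pow_mul, mul_comm, pow_mul]
  constructor
  · rintro ⟨a, ha⟩
    rw [← sq_eq_of_pow_eq h ha.symm, ← ha, map_pow]
  · intro hm
    refine mem_range_unitsIncl_of_commute hB h hx ((Commute.refl x).pow_left m) ?_
    -- Here `c^m (x^m)⁻¹ = x^m`, so the relation says that `y` commutes with `x^m`.
    have h1 := conj_pow_eq h m
    rw [← hm, pow_two, mul_assoc, mul_inv_cancel_left] at h1
    exact h1.symm

/-- The reduced trace of a generator is a scalar. -/
theorem exists_trace [Algebra.IsCentral F B] (hB : Module.finrank F B = 4)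
    {x y : Bˣ} {c : Fˣ} (h : y * x = unitsIncl F B c * (x⁻¹ * y))
    (hx : x ^ 2 ∉ (unitsIncl F B).range) :
    ∃ T : F, algebraMap F B T = x + algebraMap F B c * (x⁻¹ : Bˣ) := by
  -- Conjugation by `y` exchanges `x` and `c x⁻¹`, so it fixes their sum.
  have h1 : y * x = unitsIncl F B c * x⁻¹ * y := by rw [h, mul_assoc]
  have h2 : y * (unitsIncl F B c * x⁻¹) = x * y := by
    rw [← mul_assoc, ← (unitsIncl_commute c y).eq, mul_inv_eq_iff_eq_mul, mul_assoc, h,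
      ← mul_assoc x, ← (unitsIncl_commute c x).eq, mul_assoc, mul_inv_cancel_left]
  refine mem_range_of_commute hB h hx ?_ ?_
  · exact (Commute.refl _).add_left ((Algebra.commute_algebraMap_left _ _).mul_left
      ((Commute.refl x).inv_left.map (Units.coeHom B)))
  · have h1' := congrArg Units.val h1
    have h2' := congrArg Units.val h2
    simp only [Units.val_mul] at h1' h2'
    change (_ + _) * _ = _ * (_ + _)
    rw [add_mul, mul_add, h1']
    erw [h2']
    rw [add_comm]
    rfl

end Quaternion

/-! ### Norm-one units inverted by conjugation, and quaternion presentations -/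

section Generators

open Polynomial

variable {F B : Type*} [Field F] [DivisionRing B] [Algebra F B] {n : ℕ} {t : F}

variable (F) in
/-- A unit `z` of `B` with `z + z⁻¹ = t`, inverted by conjugation by a unit `y` with `y² = b`. -/
structure IsInvertedBy (z y : Bˣ) (t : F) (b : Fˣ) : Prop where
  trace : (z : B) + (z⁻¹ : Bˣ) = algebraMap F B t
  conj : y * z = z⁻¹ * y
  sq : y * y = unitsIncl F B b

theorem commute_of_mem_range {z : Bˣ} (hz : z ∈ (unitsIncl F B).range) (y : Bˣ) : Commute z y := by
  obtain ⟨a, rfl⟩ := hz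
  exact unitsIncl_commute a y

namespace IsInvertedBy

variable {z y : Bˣ} {b : Fˣ}

theorem pow_eq_one_iff_dvd (h : IsInvertedBy F z y t b)
    (ht : ∀ m : ℕ, (Chebyshev.C F m).eval t = 2 ↔ n ∣ m) (m : ℕ) : z ^ m = 1 ↔ n ∣ m := by
  rw [pow_eq_one_iff_eval h.trace, ht]

theorem sq_ne_one (h : IsInvertedBy F z y t b) (hn : 2 < n)
    (ht : ∀ m : ℕ, (Chebyshev.C F m).eval t = 2 ↔ n ∣ m) : z ^ 2 ≠ 1 := fun h1 =>
  absurd (Nat.le_of_dvd (by norm_num) ((h.pow_eq_one_iff_dvd ht 2).1 h1)) (by omega)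

theorem notMem_range (h : IsInvertedBy F z y t b) (hz : z ^ 2 ≠ 1) :
    z ∉ (unitsIncl F B).range := by
  intro hzF
  have h1 := h.conj
  rw [← (commute_of_mem_range hzF y).eq, mul_left_inj, ← mul_eq_one_iff_eq_inv] at h1
  exact hz (by rw [pow_two, h1])

variable (F) in
theorem exists_unit_one_add (hz : z ^ 2 ≠ 1) : ∃ x : Bˣ, (x : B) = 1 + z := by
  have : (1 : B) + z ≠ 0 := by
    intro h0
    apply hz
    apply Units.ext
    rw [Units.val_pow_eq_pow_val, eq_neg_of_add_eq_zero_right h0]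
    simp
  exact ⟨Units.mk0 _ this, rfl⟩

theorem one_add_mul (h : IsInvertedBy F z y t b) {x : Bˣ} (hx : (x : B) = 1 + z) {α : Fˣ}
    (hα : (α : F) = 2 + t) : (1 + ((z⁻¹ : Bˣ) : B)) * x = algebraMap F B α := by
  rw [hx, hα, map_add, ← h.trace, add_mul, mul_add, mul_add, Units.inv_mul, map_ofNat,
    ← one_add_one_eq_two]
  simp only [one_mul, mul_one]
  abel

/-- `y` conjugates `1 + z` to `1 + z⁻¹`, which is `α x⁻¹` because `(1 + z⁻¹)(1 + z) = 2 + t`. -/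
theorem conj_one_add (h : IsInvertedBy F z y t b) {x : Bˣ} (hx : (x : B) = 1 + z) {α : Fˣ}
    (hα : (α : F) = 2 + t) : y * x = unitsIncl F B α * (x⁻¹ * y) := by
  have h1 : (1 + ((z⁻¹ : Bˣ) : B)) = (unitsIncl F B α * x⁻¹ : Bˣ) := by
    rw [Units.val_mul, Units.eq_mul_inv_iff_mul_eq, h.one_add_mul hx hα]
    rfl
  rw [← mul_assoc]
  apply Units.ext
  have h2 := congrArg Units.val h.conj
  rw [Units.val_mul, Units.val_mul] at h2
  rw [Units.val_mul, Units.val_mul, ← h1, hx, mul_add, h2, add_mul, mul_one, one_mul]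

/-- Write one factor as `1 + z = z (1 + z⁻¹)`. -/
theorem sq_one_add (h : IsInvertedBy F z y t b) {x : Bˣ} (hx : (x : B) = 1 + z) {α : Fˣ}
    (hα : (α : F) = 2 + t) : x ^ 2 = unitsIncl F B α * z := by
  have h1 : (x : B) = z * (1 + ((z⁻¹ : Bˣ) : B)) := by
    rw [mul_add, mul_one, Units.mul_inv, hx, add_comm]
  rw [← (unitsIncl_commute α z).symm.eq]
  apply Units.ext
  rw [pow_two, Units.val_mul, Units.val_mul]
  nth_rewrite 1 [h1]
  rw [mul_assoc, h.one_add_mul hx hα]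
  rfl

theorem sq_one_add_notMem (h : IsInvertedBy F z y t b) (hz : z ^ 2 ≠ 1) {x : Bˣ}
    (hx : (x : B) = 1 + z) {α : Fˣ} (hα : (α : F) = 2 + t) :
    x ^ 2 ∉ (unitsIncl F B).range := by
  rw [h.sq_one_add hx hα]
  intro h1
  exact h.notMem_range hz ((Subgroup.mul_mem_cancel_left _ (MonoidHom.mem_range.2 ⟨α, rfl⟩)).1 h1)

/-- `x^m` is scalar iff `(α z)^m = α^m`, that is, iff `z^m = 1`. -/
theorem one_add_pow_mem_iff [Algebra.IsCentral F B] (hB : Module.finrank F B = 4)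
    (h : IsInvertedBy F z y t b) (hn : 2 < n)
    (ht : ∀ m : ℕ, (Chebyshev.C F m).eval t = 2 ↔ n ∣ m) {x : Bˣ}
    (hx : (x : B) = 1 + z) {α : Fˣ} (hα : (α : F) = 2 + t) (m : ℕ) :
    x ^ m ∈ (unitsIncl F B).range ↔ n ∣ m := by
  rw [pow_mem_range_iff hB (h.conj_one_add hx hα)
    (h.sq_one_add_notMem (h.sq_ne_one hn ht) hx hα), h.sq_one_add hx hα,
    (unitsIncl_commute α z).mul_pow, map_pow, mul_eq_left, h.pow_eq_one_iff_dvd ht]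

/-- Up to sign, `1 + z` and `y` generate a dihedral group with multiplier `2 + t`, and the `n`-th
power of the first generator is negative. -/
theorem exists_isDihedralPair [Algebra.IsCentral F B] (hB : Module.finrank F B = 4)
    (h : IsInvertedBy F z y t b) (hn : 2 < n)
    (ht : ∀ m : ℕ, (Chebyshev.C F m).eval t = 2 ↔ n ∣ m) (ι : F →+* ℝ) {α : Fˣ}
    (hα : (α : F) = 2 + t) :
    ∃ (x : Bˣ) (a ε : Fˣ), (x : B) = algebraMap F B ε * (1 + z) ∧ ι a < 0 ∧
      IsDihedralPair n x y α b a := by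
  obtain ⟨x, hx⟩ := exists_unit_one_add (h.sq_ne_one hn ht)
  have hmem := h.one_add_pow_mem_iff hB hn ht hx hα
  obtain ⟨a, ha⟩ := (hmem n).2 dvd_rfl
  have hconj := h.conj_one_add hx hα
  have hpair : IsDihedralPair n x y α b a := ⟨hconj, ha.symm, h.sq, fun m => (hmem m).1⟩
  have ha0 : ι a ≠ 0 := by simp
  rcases lt_or_gt_of_ne ha0 with hneg | hpos
  · exact ⟨x, a, 1, by simp [hx], hneg, hpair⟩
  -- Suppose `a > 0`. For `n = 2m`, `a² = (α^m)²` forces `a = α^m`; then `x^m` is already scalar and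
  -- `n ∣ m`, which is absurd. For odd `n`, replacing `x` by `-x` changes the sign of `a`.
  rcases Nat.even_or_odd' n with ⟨m, hm | hm⟩
  · exfalso
    have hαpos : 0 < ι α := by
      rw [hα, map_add, map_ofNat]
      linarith [(trace_bounds ι hn ht).1]
    have h1 : ι a ^ 2 = (ι α ^ m) ^ 2 := by
      have := congrArg (fun u : Fˣ => ι u) (sq_eq_of_pow_eq hconj ha.symm)
      simp only [Units.val_pow_eq_pow_val, map_pow] at this
      rw [this, hm, ← pow_mul, mul_comm]
    have h2 : ι a = ι α ^ m := (pow_left_inj₀ hpos.le (by positivity) (by norm_num)).1 h1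
    have h3 : a = α ^ m := Units.ext (ι.injective (by simp [h2]))
    have h4 : (x ^ 2) ^ m = unitsIncl F B (α ^ m) := by rw [← pow_mul, ← hm, ← ha, h3]
    have h5 := Nat.le_of_dvd (by omega)
      ((hmem m).1 ((pow_mem_range_iff hB hconj
        (h.sq_one_add_notMem (h.sq_ne_one hn ht) hx hα) m).2 h4))
    omega
  · have hodd : Odd n := ⟨m, hm⟩
    refine ⟨-x, -a, -1, by simp [hx], by simpa using hpos, ⟨?_, ?_, h.sq, ?_⟩⟩
    · rw [inv_neg, mul_neg, hconj, neg_mul, mul_neg]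
    · rw [hodd.neg_pow, ← ha]
      ext; simp
    · intro k hk
      rw [← hmem]
      rcases Nat.even_or_odd k with hk' | hk'
      · rwa [hk'.neg_pow] at hk
      · rw [hk'.neg_pow] at hk
        have h1 : unitsIncl F B (-1) = -1 := by ext; simp
        have h2 : -(x ^ k) = unitsIncl F B (-1) * x ^ k := by rw [h1, neg_one_mul]
        rw [h2] at hk
        exact (Subgroup.mul_mem_cancel_left _ (MonoidHom.mem_range.2 ⟨-1, rfl⟩)).1 hk

/-- The square of `z - z⁻¹`. -/
theorem sub_inv_sq (h : IsInvertedBy F z y t b) :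
    ((z : B) - (z⁻¹ : Bˣ)) * (z - (z⁻¹ : Bˣ)) = algebraMap F B (t ^ 2 - 4) := by
  have h1 : algebraMap F B (t ^ 2 - 4) =
      ((z : B) + (z⁻¹ : Bˣ)) * (z + (z⁻¹ : Bˣ)) - 4 := by
    rw [h.trace, map_sub, map_pow, map_ofNat, pow_two]
  rw [h1, sub_mul, mul_sub, mul_sub, add_mul, mul_add, mul_add, Units.mul_inv, Units.inv_mul]
  have h4 : (4 : B) = 1 + 1 + 1 + 1 := by norm_num
  rw [h4]
  abel

theorem mul_sub_inv (h : IsInvertedBy F z y t b) :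
    (y : B) * (z - (z⁻¹ : Bˣ)) = -((z - (z⁻¹ : Bˣ)) * y) := by
  have h1 := congrArg Units.val h.conj
  have h2 : y * z⁻¹ = z * y := by
    rw [mul_inv_eq_iff_eq_mul, mul_assoc, h.conj, mul_inv_cancel_left]
  have h2' := congrArg Units.val h2
  rw [Units.val_mul, Units.val_mul] at h1 h2'
  rw [mul_sub, h1, h2', sub_mul, neg_sub]

/-- `B` is the quaternion algebra `(t² - 4, b)`. -/
theorem nonempty_algEquiv [CharZero F] (hB : Module.finrank F B = 4)
    (h : IsInvertedBy F z y t b) (hz : z ^ 2 ≠ 1) {α : Fˣ} (hα : (α : F) = 2 + t) :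
    Nonempty (B ≃ₐ[F] QuaternionAlgebra F (t ^ 2 - 4) 0 (b : F)) := by
  let q : QuaternionAlgebra.Basis B (t ^ 2 - 4) 0 (b : F) :=
    { i := z - (z⁻¹ : Bˣ)
      j := y
      k := (z - (z⁻¹ : Bˣ)) * y
      i_mul_i := by rw [h.sub_inv_sq, zero_smul, add_zero, Algebra.algebraMap_eq_smul_one]
      j_mul_j := by
        have := congrArg Units.val h.sq
        rw [Units.val_mul] at this
        rw [this, ← Algebra.algebraMap_eq_smul_one]
        rfl
      i_mul_j := rfl
      j_mul_i := by rw [h.mul_sub_inv, zero_smul, zero_sub] }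
  obtain ⟨x, hx⟩ := exists_unit_one_add hz
  have hi : (z : B) - (z⁻¹ : Bˣ) ∈ q.liftHom.range := by
    rw [q.range_liftHom]; exact Algebra.subset_adjoin (by simp [q])
  have hj : (y : B) ∈ q.liftHom.range := by
    rw [q.range_liftHom]; exact Algebra.subset_adjoin (by simp [q])
  have hz' : (z : B) ∈ q.liftHom.range := by
    -- As `z + z⁻¹ = t`, `z` is recovered as `(t + i)/2`; so the image contains the generators `1 +
    -- z` and `y`.
    have h1 : (z : B) = (2⁻¹ : F) • (algebraMap F B t + (z - (z⁻¹ : Bˣ))) := by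
      rw [← h.trace, add_add_sub_cancel, ← two_smul F (z : B), smul_smul,
        inv_mul_cancel₀ two_ne_zero, one_smul]
    rw [h1]
    exact Subalgebra.smul_mem _ (add_mem (Subalgebra.algebraMap_mem _ t) hi) _
  have htop := subalgebra_eq_top_of_conj hB (h.conj_one_add hx hα)
    (h.sq_one_add_notMem hz hx hα) q.liftHom.range
    (by rw [hx]; exact add_mem (one_mem _) hz') hj
  have hsurj : Function.Surjective q.liftHom := AlgHom.range_eq_top _ |>.1 htop
  have : FiniteDimensional F B := FiniteDimensional.of_finrank_pos (by omega)
  have hinj : Function.Injective q.liftHom :=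
    (LinearMap.injective_iff_surjective_of_finrank_eq_finrank (f := q.liftHom.toLinearMap)
      (by rw [QuaternionAlgebra.finrank_eq_four, hB])).2 hsurj
  exact ⟨(AlgEquiv.ofBijective q.liftHom ⟨hinj, hsurj⟩).symm⟩

end IsInvertedBy

/-- A presentation of `B` as `(t² - 4, b)` provides a unit inverted by conjugation. -/
theorem exists_isInvertedBy [CharZero F] {b : Fˣ}
    (e : B ≃ₐ[F] QuaternionAlgebra F (t ^ 2 - 4) 0 (b : F)) :
    ∃ z y : Bˣ, IsInvertedBy F z y t b := by
  -- `z₁ = (t + i)/2` has norm `(t² - i²)/4 = 1`, so its conjugate `z₂` is its inverse; `y₁ = j`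
  -- exchanges the two.
  let z₁ : QuaternionAlgebra F (t ^ 2 - 4) 0 (b : F) := ⟨t / 2, 1 / 2, 0, 0⟩
  let z₂ : QuaternionAlgebra F (t ^ 2 - 4) 0 (b : F) := ⟨t / 2, -(1 / 2), 0, 0⟩
  let y₁ : QuaternionAlgebra F (t ^ 2 - 4) 0 (b : F) := ⟨0, 0, 1, 0⟩
  let y₂ : QuaternionAlgebra F (t ^ 2 - 4) 0 (b : F) := ⟨0, 0, (b : F)⁻¹, 0⟩
  have hb : (b : F) ≠ 0 := b.ne_zero
  have h1 : z₁ * z₂ = 1 := by ext <;> simp [z₁, z₂] <;> field_simp <;> ring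
  have h2 : z₂ * z₁ = 1 := by ext <;> simp [z₁, z₂] <;> field_simp <;> ring
  have h3 : y₁ * y₂ = 1 := by ext <;> simp [y₁, y₂]
  have h4 : y₂ * y₁ = 1 := by ext <;> simp [y₁, y₂]
  have h5 : y₁ * z₁ = z₂ * y₁ := by ext <;> simp [y₁, z₁, z₂]
  have h6 : y₁ * y₁ = algebraMap F _ (b : F) := by
    ext <;> simp [y₁, QuaternionAlgebra.algebraMap_eq]
  have h7 : z₁ + z₂ = algebraMap F _ t := by
    ext <;> simp [z₁, z₂, QuaternionAlgebra.algebraMap_eq]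
  refine ⟨⟨e.symm z₁, e.symm z₂, by rw [← map_mul, h1, map_one], by rw [← map_mul, h2, map_one]⟩,
    ⟨e.symm y₁, e.symm y₂, by rw [← map_mul, h3, map_one], by rw [← map_mul, h4, map_one]⟩,
    ?_, ?_, ?_⟩
  · simp only [Units.inv_mk]
    rw [← map_add, h7, AlgEquiv.commutes]
  · apply Units.ext
    simp only [Units.inv_mk, Units.val_mul]
    rw [← map_mul, h5, map_mul]
  · apply Units.ext
    simp only [Units.val_mul]
    rw [← map_mul, h6, AlgEquiv.commutes]
    rfl

/-- Two anticommuting real matrices of order two do not both have negative scalar squares. -/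
theorem pos_of_anticommuting {I J : Matrix (Fin 2) (Fin 2) ℝ} {d b : ℝ} (hd : d < 0)
    (hb : b ≠ 0) (hI : I * I = algebraMap ℝ _ d) (hJ : J * J = algebraMap ℝ _ b)
    (hIJ : J * I = -(I * J)) : 0 < b := by
  by_contra hb'
  have hb'' : b < 0 := lt_of_le_of_ne (not_lt.1 hb') hb
  -- A real matrix with negative scalar square has trace zero: otherwise its `(0,1)` entry vanishes
  -- and `M 0 0` would have negative square.
  have key : ∀ (M : Matrix (Fin 2) (Fin 2) ℝ) (c : ℝ), c < 0 → M * M = algebraMap ℝ _ c →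
      M 1 1 = -M 0 0 ∧ M 0 0 * M 0 0 + M 0 1 * M 1 0 < 0 := by
    intro M c hc hM
    have e00 := congrFun (congrFun hM 0) 0
    have e01 := congrFun (congrFun hM 0) 1
    have e10 := congrFun (congrFun hM 1) 0
    simp only [Matrix.mul_apply, Fin.sum_univ_two, Matrix.algebraMap_matrix_apply,
      Algebra.algebraMap_self, RingHom.id_apply, if_true, if_neg zero_ne_one,
      if_neg one_ne_zero] at e00 e01 e10
    refine ⟨?_, by linarith⟩
    have h1 : M 0 1 * (M 0 0 + M 1 1) = 0 := by linarith
    rcases mul_eq_zero.1 h1 with h2 | h2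
    · rw [h2] at e00
      nlinarith [mul_self_nonneg (M 0 0)]
    · linarith
  obtain ⟨i1, i2⟩ := key I d hd hI
  obtain ⟨j1, j2⟩ := key J b hb'' hJ
  have e00 := congrFun (congrFun hIJ 0) 0
  have e11 := congrFun (congrFun hIJ 1) 1
  simp only [Matrix.mul_apply, Fin.sum_univ_two, Matrix.neg_apply] at e00 e11
  rw [i1, j1] at e11
  have h1 : 2 * (I 0 0 * J 0 0) = -(I 0 1 * J 1 0 + I 1 0 * J 0 1) := by linarith
  have h2 : (2 * (I 0 0 * J 0 0)) ^ 2 = (I 0 1 * J 1 0 + I 1 0 * J 0 1) ^ 2 := by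
    rw [h1, neg_sq]
  -- With `p = I₀₁J₁₀` and `q = I₁₀J₀₁`, this says `pq > (I₀₀J₀₀)²`, while `h2` gives `4 (I₀₀J₀₀)² =
  -- (p + q)² ≥ 4pq`.
  have h3 : I 0 0 * I 0 0 * (J 0 0 * J 0 0) < (-(I 0 1 * I 1 0)) * (-(J 0 1 * J 1 0)) :=
    mul_lt_mul'' (by linarith) (by linarith) (mul_self_nonneg _) (mul_self_nonneg _)
  nlinarith [sq_nonneg (I 0 1 * J 1 0 - I 1 0 * J 0 1)]

/-- At the place `ι` the algebra becomes `M₂(ℝ)`, where the images of `z - z⁻¹` and `y` anticommute.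
Two negative squares would embed Hamilton's quaternions. -/
theorem IsInvertedBy.pos_of_isTotallyIndefinite (hind : IsTotallyIndefinite F B) (ι : F →+* ℝ)
    {z y : Bˣ} {b : Fˣ} (h : IsInvertedBy F z y t b) (ht : ι (t ^ 2 - 4) < 0) : 0 < ι b := by
  let := ι.toAlgebra
  obtain ⟨e⟩ := hind ι
  let f : B →+* Matrix (Fin 2) (Fin 2) ℝ :=
    (e : TensorProduct F ℝ B →+* Matrix (Fin 2) (Fin 2) ℝ).comp
      (Algebra.TensorProduct.includeRight : B →ₐ[F] TensorProduct F ℝ B).toRingHom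
  have hf : ∀ c : F, f (algebraMap F B c) = algebraMap ℝ _ (ι c) := by
    intro c
    change e (Algebra.TensorProduct.includeRight (algebraMap F B c)) = _
    rw [AlgHom.commutes, ← e.commutes]
    rfl
  refine pos_of_anticommuting (I := f (z - (z⁻¹ : Bˣ))) (J := f y) ht (by simp) ?_ ?_ ?_
  · rw [← map_mul, h.sub_inv_sq, hf]
  · have h1 := congrArg Units.val h.sq
    rw [Units.val_mul] at h1
    rw [← map_mul, h1]
    exact hf b
  · rw [← map_mul, h.mul_sub_inv, map_neg, map_mul]

end Generators

/-! ### Normal form of a dihedral subgroup of `Bˣ/Fˣ` -/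

section Subgroups

open Polynomial DihedralGroup

variable {F B : Type*} [Field F] [DivisionRing B] [Algebra F B] {n : ℕ}

/-- A dihedral subgroup of `Bˣ / Fˣ` is generated by the classes of `1 + z` and `y`, where `y`
inverts `z` and `z` has the trace of a prescribed primitive root of unity. -/
theorem exists_isInvertedBy_of_subgroup [CharZero F] [Algebra.IsCentral F B]
    (hB : Module.finrank F B = 4) (hn : 2 < n) (H : Subgroup (ProjUnits F B))
    (e : H ≃* DihedralGroup n) {ζ : AlgebraicClosure F} (hζ : IsPrimitiveRoot ζ n) :
    ∃ t : F, algebraMap F (AlgebraicClosure F) t = ζ + ζ⁻¹ ∧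
      (∀ m : ℕ, (Chebyshev.C F m).eval t = 2 ↔ n ∣ m) ∧
      ∃ (z y : Bˣ) (b : Fˣ), IsInvertedBy F z y t b ∧ (y : ProjUnits F B) ∈ H ∧
        ∀ (x : Bˣ) (ε : Fˣ), (x : B) = algebraMap F B ε * (1 + z) → (x : ProjUnits F B) ∈ H := by
  obtain ⟨X, hX⟩ := QuotientGroup.mk_surjective (e.symm (r 1) : ProjUnits F B)
  obtain ⟨Y, hY⟩ := QuotientGroup.mk_surjective (e.symm (sr 0) : ProjUnits F B)
  have hXH : (X : ProjUnits F B) ∈ H := hX ▸ (e.symm (r 1)).2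
  have hYH : (Y : ProjUnits F B) ∈ H := hY ▸ (e.symm (sr 0)).2
  have hdvd : ∀ m : ℕ, X ^ m ∈ (unitsIncl F B).range ↔ n ∣ m := by
    intro m
    rw [← QuotientGroup.eq_one_iff, QuotientGroup.mk_pow, hX, ← Subgroup.coe_pow,
      OneMemClass.coe_eq_one, ← map_pow, MulEquiv.map_eq_one_iff, ← orderOf_dvd_iff_pow_eq_one,
      orderOf_r_one]
  obtain ⟨b, hb⟩ : Y * Y ∈ (unitsIncl F B).range := by
    rw [← QuotientGroup.eq_one_iff, QuotientGroup.mk_mul, hY, ← Subgroup.coe_mul, ← map_mul,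
      sr_mul_self, map_one, Subgroup.coe_one]
  obtain ⟨c, hc⟩ : Y * X * Y⁻¹ * X ∈ (unitsIncl F B).range := by
    rw [← QuotientGroup.eq_one_iff]
    simp only [QuotientGroup.mk_mul, QuotientGroup.mk_inv, hX, hY, ← Subgroup.coe_mul,
      ← Subgroup.coe_inv, ← map_mul, ← map_inv]
    simp
  have hconj : Y * X = unitsIncl F B c * (X⁻¹ * Y) := by rw [hc]; group
  have hX2 : X ^ 2 ∉ (unitsIncl F B).range := fun h =>
    absurd (Nat.le_of_dvd (by norm_num) ((hdvd 2).1 h)) (by omega)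
  -- Dividing `X²` by `c` gives norm one; by `pow_mem_range_iff`, `z₁^m = 1` iff `X^m` is scalar, so
  -- the order is exactly `n`.
  obtain ⟨z₁, hz₁⟩ : ∃ z₁ : Bˣ, z₁ = unitsIncl F B c⁻¹ * X ^ 2 := ⟨_, rfl⟩
  have hz₁inv : z₁⁻¹ = unitsIncl F B c * (X ^ 2)⁻¹ := by
    rw [hz₁, mul_inv_rev, map_inv, inv_inv, (unitsIncl_commute c _).eq]
  have hz₁pow : ∀ m, z₁ ^ m = 1 ↔ n ∣ m := by
    intro m
    rw [hz₁, (unitsIncl_commute _ _).mul_pow, ← map_pow, inv_pow, map_inv, inv_mul_eq_one,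
      eq_comm, ← pow_mem_range_iff hB hconj hX2, hdvd]
  have hconj₁ : Y * z₁ = z₁⁻¹ * Y := by
    rw [hz₁inv, hz₁, ← mul_assoc, ← (unitsIncl_commute c⁻¹ Y).eq, mul_assoc, conj_pow_eq hconj,
      ← mul_assoc, ← map_mul, ← mul_assoc]
    congr 3
    rw [pow_two, inv_mul_cancel_left]
  obtain ⟨t₁, ht₁⟩ : ∃ t₁ : F, (z₁ : B) + (z₁⁻¹ : Bˣ) = algebraMap F B t₁ := by
    have hz₁2 : z₁ ^ 2 ≠ 1 := fun h =>
      absurd (Nat.le_of_dvd (by norm_num) ((hz₁pow 2).1 h)) (by omega)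
    obtain ⟨a, ha⟩ := mem_range_of_commute hB hconj hX2 (z := (z₁ : B) + (z₁⁻¹ : Bˣ)) (by
      have h1 : Commute z₁ X := by
        rw [hz₁]
        exact (unitsIncl_commute _ _).mul_left ((Commute.refl X).pow_left 2)
      exact (h1.map (Units.coeHom B)).add_left (h1.inv_left.map (Units.coeHom B))) (by
      have h2 : Y * z₁⁻¹ = z₁ * Y := by
        rw [mul_inv_eq_iff_eq_mul, mul_assoc, hconj₁, mul_inv_cancel_left]
      have h1' := congrArg Units.val hconj₁
      have h2' := congrArg Units.val h2
      rw [Units.val_mul, Units.val_mul] at h1' h2'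
      change _ * _ = _ * _
      rw [mul_add, h1', h2', add_mul, add_comm])
    exact ⟨a, ha.symm⟩
  -- `w` has the trace of `z₁`, hence is a primitive `n`-th root of unity. So `ζ = w^k` with `k`
  -- prime to `n`, and `z₁^k` has trace `ζ + ζ⁻¹`.
  obtain ⟨w, hw⟩ := exists_add_inv_eq (AlgebraicClosure F) (algebraMap F _ t₁)
  have hwprim : IsPrimitiveRoot w n :=
    ⟨by rw [pow_eq_one_iff_eval hw, ← pow_eq_one_iff_eval ht₁, hz₁pow], fun m hm => by
      rwa [pow_eq_one_iff_eval hw, ← pow_eq_one_iff_eval ht₁, hz₁pow] at hm⟩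
  have : NeZero n := ⟨by omega⟩
  obtain ⟨k, -, hk, hk'⟩ := ((IsPrimitiveRoot.coe_units_iff.2 hwprim).isPrimitiveRoot_iff).1 hζ
  have ht := pow_add_inv_pow hw k
  have hζw : ((w ^ k : (AlgebraicClosure F)ˣ) : AlgebraicClosure F) = ζ := by simpa using hk'
  have hζw' : (((w ^ k)⁻¹ : (AlgebraicClosure F)ˣ) : AlgebraicClosure F) = ζ⁻¹ := by
    rw [Units.val_inv_eq_inv_val, hζw]
  have hζt := ht
  rw [hζw, hζw'] at hζt
  have hinv : IsInvertedBy F (z₁ ^ k) Y ((Chebyshev.C F k).eval t₁) b := by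
    refine ⟨pow_add_inv_pow ht₁ k, ?_, hb.symm⟩
    have := conj_pow_eq (x := z₁) (y := Y) (α := (1 : Fˣ)) (by rw [map_one, one_mul, hconj₁]) k
    rwa [one_pow, map_one, one_mul] at this
  refine ⟨(Chebyshev.C F k).eval t₁, hζt.symm, ?_, z₁ ^ k, Y, b, hinv, hYH, ?_⟩
  · intro m
    rw [← pow_eq_one_iff_eval ht m]
    have h1 : IsPrimitiveRoot (w ^ k) n := IsPrimitiveRoot.coe_units_iff.1 (by rwa [hζw])
    exact h1.pow_eq_one_iff_dvd m
  · intro x ε hx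
    have hXk : (X ^ k) ^ 2 ∉ (unitsIncl F B).range := by
      rw [← pow_mul, hdvd]
      intro h1
      have := Nat.le_of_dvd (by norm_num) (Nat.Coprime.dvd_of_dvd_mul_left hk.symm h1)
      omega
    obtain ⟨T, hT⟩ := exists_trace hB (conj_pow_eq hconj k) hXk
    -- With `T = X^k + c^k X^{-k}`, one has `1 + z₁^k = c^{-k} T X^k`: a scalar multiple of `X^k`,
    -- so its class stays in `H`.
    have h1 : (1 : B) + (z₁ ^ k : Bˣ) = algebraMap F B (((c ^ k)⁻¹ : Fˣ) * T) * (X ^ k : Bˣ) := by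
      have e1 : algebraMap F B (((c ^ k)⁻¹ : Fˣ) : F) * algebraMap F B ((c ^ k : Fˣ) : F) = 1 := by
        rw [← map_mul, Units.inv_mul, map_one]
      have e2 : ((z₁ ^ k : Bˣ) : B) =
          algebraMap F B (((c ^ k)⁻¹ : Fˣ) : F) * ((X ^ k : Bˣ) * (X ^ k : Bˣ)) := by
        rw [hz₁, (unitsIncl_commute _ _).mul_pow, ← map_pow, inv_pow, ← pow_mul, mul_comm 2 k,
          pow_mul, pow_two, Units.val_mul, Units.val_mul]
        rfl
      rw [map_mul, hT, e2, mul_assoc, add_mul, mul_assoc, Units.inv_mul, mul_one, mul_add, e1,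
        add_comm]
    rw [h1, ← mul_assoc, ← map_mul] at hx
    have ha0 : (ε : F) * (((c ^ k)⁻¹ : Fˣ) * T) ≠ 0 := by
      intro h0
      rw [h0, map_zero, zero_mul] at hx
      exact x.ne_zero hx
    have hx' : x = unitsIncl F B (Units.mk0 _ ha0) * X ^ k := Units.ext hx
    have h2 : (x : ProjUnits F B) = (X : ProjUnits F B) ^ k := by
      rw [hx', QuotientGroup.mk_mul, (QuotientGroup.eq_one_iff _).2 (MonoidHom.mem_range.2 ⟨_, rfl⟩), one_mul,
        QuotientGroup.mk_pow]
    rw [h2]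
    exact H.pow_mem hXH k

end Subgroups

/-! ### The subgroups of the dihedral group cut out by `K(√s)` and `K(√t)` -/

section Characters

open DihedralGroup

variable {n : ℕ}

theorem iso_mem_closure_σ {K : Type*} [Field K] (E : DihedralExtension K n) (g : DihedralGroup n) :
    E.iso g ∈ Subgroup.closure {E.σ} ↔ g ∈ Subgroup.zpowers (r 1 : DihedralGroup n) := by
  rw [← Subgroup.zpowers_eq_closure, DihedralExtension.σ]
  rw [← MulEquiv.coe_toMonoidHom, ← MonoidHom.map_zpowers]
  exact Subgroup.mem_map_iff_mem (f := E.iso.toMonoidHom) E.iso.injective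

theorem iso_mem_closure_σ_τ {K : Type*} [Field K] (E : DihedralExtension K n) (g : DihedralGroup n) :
    E.iso g ∈ Subgroup.closure {E.σ ^ 2, E.τ} ↔
      g ∈ Subgroup.closure {(r 2 : DihedralGroup n), sr 0} := by
  have h1 : ({E.σ ^ 2, E.τ} : Set Gal(E.M/K)) =
      E.iso.toMonoidHom '' {(r 2 : DihedralGroup n), sr 0} := by
    rw [Set.image_pair, DihedralExtension.σ, DihedralExtension.τ, ← map_pow, r_one_pow]
    simp
  rw [h1, ← MonoidHom.map_closure]
  exact Subgroup.mem_map_iff_mem (f := E.iso.toMonoidHom) E.iso.injective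

theorem r_mem_zpowers [NeZero n] (i : ZMod n) : r i ∈ Subgroup.zpowers (r 1 : DihedralGroup n) :=
  ⟨(i.val : ℤ), by simp⟩

theorem sr_notMem_zpowers (i : ZMod n) : sr i ∉ Subgroup.zpowers (r 1 : DihedralGroup n) := by
  rintro ⟨k, hk⟩
  simp at hk

/-- For odd `n` the elements `σ²` and `τ` generate the dihedral group. -/
theorem closure_eq_top_of_odd [NeZero n] (hn : Odd n) :
    Subgroup.closure {(r 2 : DihedralGroup n), sr 0} = ⊤ := by
  set H := Subgroup.closure {(r 2 : DihedralGroup n), sr 0}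
  have h2 : r 2 ∈ H := Subgroup.subset_closure (by simp)
  have hs : sr 0 ∈ H := Subgroup.subset_closure (by simp)
  have hr1 : r 1 ∈ H := by
    obtain ⟨m, hm⟩ := hn
    -- `2(m + 1) = n + 1`, so this power of `σ²` is `σ`.
    have h3 : (r 2 : DihedralGroup n) ^ (m + 1) = r 1 := by
      rw [r_pow]
      congr 1
      have : ((2 * m + 1 : ℕ) : ZMod n) = 0 := by rw [← hm]; simp
      push_cast at this ⊢
      linear_combination this
    rw [← h3]
    exact H.pow_mem h2 _
  have hr : ∀ i, r i ∈ H := fun i => (Subgroup.zpowers_le.2 hr1) (r_mem_zpowers i)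
  rw [eq_top_iff]
  rintro (i | i) -
  · exact hr i
  · have : sr i = sr 0 * r i := by simp
    rw [this]
    exact H.mul_mem hs (hr i)

/-- For even `n` neither reduction modulo `n` nor negation changes parity, so the parity of the
exponent is a character. -/
theorem even_expo_mul [NeZero n] (hn : Even n) (g g' : DihedralGroup n) :
    Even (expo (g * g')) ↔ (Even (expo g) ↔ Even (expo g')) := by
  have hadd : ∀ u v : ZMod n, Even (u + v).val ↔ (Even u.val ↔ Even v.val) := by
    intro u v
    rw [← Nat.even_add, zmod_val_add]
    split_ifs with h
    · rfl
    · rw [Nat.even_sub (not_lt.1 h)]; simp [hn]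
  have hneg : ∀ u : ZMod n, Even (-u).val ↔ Even u.val := by
    intro u
    have := hadd (-u) u
    rw [neg_add_cancel, ZMod.val_zero] at this
    exact this.1 (by simp)
  rcases g with u | u <;> rcases g' with v | v <;>
    simp only [r_mul_r, r_mul_sr, sr_mul_r, sr_mul_sr, expo, hneg, hadd, sub_eq_add_neg] <;>
    tauto

theorem even_expo_one [NeZero n] : Even (expo (1 : DihedralGroup n)) := by
  rw [one_def]; simp [expo]

/-- For even `n`, the subgroup `⟨σ², τ⟩` consists of the `σ^i τ^j` with `i` even. -/
theorem mem_closure_iff_of_even [NeZero n] (hn : Even n) (g : DihedralGroup n) :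
    g ∈ Subgroup.closure {(r 2 : DihedralGroup n), sr 0} ↔ Even (expo g) := by
  set H := Subgroup.closure {(r 2 : DihedralGroup n), sr 0}
  have h2 : r 2 ∈ H := Subgroup.subset_closure (by simp)
  have hs : sr 0 ∈ H := Subgroup.subset_closure (by simp)
  constructor
  · intro hg
    induction hg using Subgroup.closure_induction with
    | mem x hx =>
      rcases hx with rfl | rfl
      · have h1 := even_expo_mul hn (r 1) (r 1)
        rw [r_mul_r, one_add_one_eq_two] at h1
        exact h1.2 Iff.rfl
      · simp [expo]
    | one => exact even_expo_one
    | mul x y _ _ hx hy => exact (even_expo_mul hn x y).2 (iff_of_true hx hy)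
    | inv x _ hx =>
      have h1 := even_expo_mul hn x x⁻¹
      rw [mul_inv_cancel] at h1
      exact (h1.1 even_expo_one).1 hx
  · intro hg
    have hr : ∀ i : ZMod n, Even i.val → r i ∈ H := by
      rintro i ⟨m, hm⟩
      have h3 : (r 2 : DihedralGroup n) ^ m = r i := by
        rw [r_pow]
        congr 1
        rw [← ZMod.natCast_zmod_val i, hm]
        push_cast; ring
      rw [← h3]
      exact H.pow_mem h2 _
    rcases g with i | i
    · exact hr i hg
    · have : sr i = sr 0 * r i := by simp
      rw [this]
      refine H.mul_mem hs (hr i ?_)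
      have h1 := even_expo_mul hn (sr 0) (sr i)
      rw [sr_mul_sr, sub_zero] at h1
      exact h1.2 (iff_of_true (by simp [expo]) hg)

/-- There is a character of the dihedral group with kernel `⟨σ⟩`. -/
theorem exists_character_zpowers [NeZero n] : ∃ χ : DihedralGroup n →* ℤˣ,
    ∀ g, χ g = 1 ↔ g ∈ Subgroup.zpowers (r 1 : DihedralGroup n) := by
  refine ⟨MonoidHom.mk' (fun g => match g with | r _ => 1 | sr _ => -1) ?_, ?_⟩
  · rintro (u | u) (v | v) <;> simp
  · rintro (u | u)
    · simpa using r_mem_zpowers u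
    · simpa using sr_notMem_zpowers u

/-- There is a character of the dihedral group with kernel `⟨σ², τ⟩`. -/
theorem exists_character_closure [NeZero n] : ∃ χ : DihedralGroup n →* ℤˣ,
    ∀ g, χ g = 1 ↔ g ∈ Subgroup.closure {(r 2 : DihedralGroup n), sr 0} := by
  rcases Nat.even_or_odd n with hn | hn
  · refine ⟨MonoidHom.mk' (fun g => (-1) ^ expo g) fun g g' => ?_, fun g => ?_⟩
    · rw [← pow_add, neg_one_pow_congr]
      rw [even_expo_mul hn, Nat.even_add]
    · rw [mem_closure_iff_of_even hn]
      change (-1 : ℤˣ) ^ expo g = 1 ↔ _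
      exact neg_one_pow_eq_one_iff_even (by decide)
  · exact ⟨1, fun g => by simp [closure_eq_top_of_odd hn]⟩

end Characters

/-! ### The quadratic characters, and the two directions of the characterisation -/

section Main

open Polynomial DihedralGroup

variable {F : Type*} [Field F] {K : Type*} [Field K] {n : ℕ} {t : F}

theorem toPmodSq_pow (a : Fˣ) (k : ℕ) [Decidable (Even k)] :
    toPmodSq (a ^ k) = if Even k then 1 else toPmodSq a := by
  split_ifs with h
  · obtain ⟨m, rfl⟩ := h
    rw [pow_add, map_mul, ← map_mul, ← mul_pow, map_pow, map_mul, toPmodSq_sq, one_pow]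
  · obtain ⟨m, rfl⟩ := Nat.not_even_iff_odd.1 h
    rw [pow_succ, map_mul, mul_comm 2 m, pow_mul, pow_two, map_mul, toPmodSq_sq, one_mul]

/-- For odd `n`, `2 + ζ + ζ⁻¹` is a square. -/
theorem toPmodSq_eq_one_of_odd {ζ : AlgebraicClosure F} (hζ : IsPrimitiveRoot ζ n) (hn : Odd n)
    (ht : algebraMap F (AlgebraicClosure F) t = ζ + ζ⁻¹) {α : Fˣ} (hα : (α : F) = 2 + t) :
    toPmodSq α = 1 := by
  have hζ0 : ζ ≠ 0 := hζ.ne_zero hn.pos.ne'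
  obtain ⟨m, hm⟩ := hn
  -- `η = ζ^(m+1)` satisfies `η² = ζ`, so `2 + ζ + ζ⁻¹ = (η + η⁻¹)²`, and `η + η⁻¹` is a Chebyshev
  -- value at `t`, hence in `F`.
  have h1 := pow_add_inv_pow (z := Units.mk0 ζ hζ0) (t := t) (by rw [ht]; simp) (m + 1)
  set v := (Chebyshev.C F ((m + 1 : ℕ) : ℤ)).eval t
  have hpow : ζ ^ (m + 1) * ζ ^ (m + 1) = ζ := by
    rw [← pow_add, show m + 1 + (m + 1) = n + 1 by omega, pow_succ, hζ.pow_eq_one, one_mul]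
  have h2 : α = v * v := by
    apply (algebraMap F (AlgebraicClosure F)).injective
    rw [hα, map_add, map_mul, ht, ← h1, map_ofNat]
    simp only [Units.val_inv_eq_inv_val, Units.val_pow_eq_pow_val, Units.val_mk0]
    have hη : ζ ^ (m + 1) ≠ 0 := pow_ne_zero _ hζ0
    generalize ζ ^ (m + 1) = η at *
    rw [← hpow]
    field_simp
    ring
  have hv : v ≠ 0 := by
    rintro hv
    rw [hv, mul_zero] at h2
    exact α.ne_zero h2
  have h3 : α = Units.mk0 v hv * Units.mk0 v hv := Units.ext h2
  rw [h3, map_mul, toPmodSq_sq]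

namespace DihedralExtension

variable (E : DihedralExtension K n)

theorem sqrtField_eq_iff_r [CharZero K] (t : Kˣ) :
    sqrtField t = E.fixed (Subgroup.closure {E.σ}) ↔
      ∀ ρ : GalK K, (∀ x ∈ sqrtField t, ρ x = x) ↔
        E.proj ρ ∈ Subgroup.zpowers (r 1 : DihedralGroup n) := by
  simp only [sqrtField_eq_fixed_iff, iso_mem_closure_σ]

theorem sqrtField_eq_iff_closure [CharZero K] (s : Kˣ) :
    sqrtField s = E.fixed (Subgroup.closure {E.σ ^ 2, E.τ}) ↔
      ∀ ρ : GalK K, (∀ x ∈ sqrtField s, ρ x = x) ↔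
        E.proj ρ ∈ Subgroup.closure {(r 2 : DihedralGroup n), sr 0} := by
  simp only [sqrtField_eq_fixed_iff, iso_mem_closure_σ_τ]

theorem exists_sqrtField_eq_r [CharZero K] [NeZero n] :
    ∃ t : Kˣ, sqrtField t = E.fixed (Subgroup.closure {E.σ}) := by
  obtain ⟨χ, hχ⟩ := exists_character_zpowers (n := n)
  obtain ⟨t, ht⟩ := exists_sqrtField (χ.comp E.proj) (E.isLocallyConstant_proj.comp χ)
  exact ⟨t, (E.sqrtField_eq_iff_r t).2 fun ρ => (ht ρ).trans (hχ _)⟩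

theorem exists_sqrtField_eq_closure [CharZero K] [NeZero n] :
    ∃ s : Kˣ, sqrtField s = E.fixed (Subgroup.closure {E.σ ^ 2, E.τ}) := by
  obtain ⟨χ, hχ⟩ := exists_character_closure (n := n)
  obtain ⟨s, hs⟩ := exists_sqrtField (χ.comp E.proj) (E.isLocallyConstant_proj.comp χ)
  exact ⟨s, (E.sqrtField_eq_iff_closure s).2 fun ρ => (hs ρ).trans (hχ _)⟩

/-- Modulo squares only the parity of `i` in `α^i` matters, and for even `n` it is the character
cutting out `K(√s)`. For odd `n` the class of `α` is trivial. -/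
theorem quadMorphism_mul_apply [CharZero K] [NeZero n] {s t : Kˣ} {α b : Fˣ}
    (hs : sqrtField s = E.fixed (Subgroup.closure {E.σ ^ 2, E.τ}))
    (ht : sqrtField t = E.fixed (Subgroup.closure {E.σ})) (hodd : Odd n → toPmodSq α = 1)
    (ρ : GalK K) :
    (quadMorphism s α * quadMorphism t b) ρ = toPmodSq (dihedralNorm α b (E.proj ρ)) := by
  classical
  have hsα : quadMorphism s α ρ = toPmodSq (α ^ expo (E.proj ρ)) := by
    rw [quadMorphism_apply, if_congr ((E.sqrtField_eq_iff_closure s).1 hs ρ) rfl rfl,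
      toPmodSq_pow]
    rcases Nat.even_or_odd n with hn | hn
    · rw [if_congr (mem_closure_iff_of_even hn _) rfl rfl]
    · simp [hodd hn]
  rw [MonoidHom.mul_apply, hsα, quadMorphism_apply,
    if_congr ((E.sqrtField_eq_iff_r t).1 ht ρ) rfl rfl]
  rcases E.proj ρ with u | u
  · rw [if_pos (r_mem_zpowers u), mul_one]; rfl
  · rw [if_neg (sr_notMem_zpowers u), ← map_mul]; rfl

theorem proj_surjective : Function.Surjective E.proj :=
  E.iso.symm.surjective.comp (AlgEquiv.restrictNormalHom_surjective _)

end DihedralExtension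

variable {B : Type*} [DivisionRing B] [Algebra F B] [Algebra.IsCentral F B]

theorem mem_deltaSet_iff [CharZero F] [CharZero K] (ι : F →+* ℝ) (hB : Module.finrank F B = 4)
    (hind : IsTotallyIndefinite F B) (hn : 2 < n) {ζ : AlgebraicClosure F}
    (hζ : IsPrimitiveRoot ζ n) (hζt : algebraMap F (AlgebraicClosure F) t = ζ + ζ⁻¹)
    (ht : ∀ m : ℕ, (Chebyshev.C F m).eval t = 2 ↔ n ∣ m) {α d : Fˣ} (hα : (α : F) = 2 + t)
    (hd : (d : F) = t ^ 2 - 4) (γ : H2 (GalK K) Fˣ) :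
    γ ∈ DeltaSet F B K (DihedralGroup n) ↔
      ∃ (hγ : γ ∈ H2two (GalK K) Fˣ) (E : DihedralExtension K n) (s t : Kˣ) (b : Fˣ),
        sqrtField s = E.fixed (Subgroup.closure {E.σ ^ 2, E.τ}) ∧
        sqrtField t = E.fixed (Subgroup.closure {E.σ}) ∧
        Nonempty (B ≃ₐ[F] QuaternionAlgebra F (d : F) 0 (b : F)) ∧
        barComponent ⟨γ, hγ⟩ = quadMorphism s α * quadMorphism t b ∧
        signComponent ι γ = E.signClass hn := by
  have : NeZero n := ⟨by omega⟩
  have hodd : Odd n → toPmodSq α = 1 := fun h => toPmodSq_eq_one_of_odd hζ h hζt hα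
  obtain ⟨ht1, ht2⟩ := trace_bounds ι hn ht
  have hαpos : 0 < ι α := by rw [hα, map_add, map_ofNat]; linarith
  have hdneg : ι (t ^ 2 - 4) < 0 := by
    rw [map_sub, map_pow, map_ofNat]
    nlinarith
  rw [hd]
  constructor
  · rintro ⟨hγ, ψ, hψ, ⟨e⟩, rfl⟩
    obtain ⟨t', ht', -, z, y, b, hinv, hyH, hxH⟩ :=
      exists_isInvertedBy_of_subgroup hB hn ψ.range e hζ
    obtain rfl : t' = t := (algebraMap F (AlgebraicClosure F)).injective (ht'.trans hζt.symm)
    have hb := hinv.pos_of_isTotallyIndefinite hind ι hdneg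
    obtain ⟨x, a, ε, hx, ha, h⟩ := hinv.exists_isDihedralPair hB hn ht ι hα
    have hinj := h.hom_injective hn
    have hle : h.hom.range ≤ ψ.range := by
      rintro _ ⟨u | u, rfl⟩
      · exact ψ.range.pow_mem (hxH x ε hx) _
      · exact ψ.range.mul_mem (ψ.range.pow_mem (hxH x ε hx) _) hyH
    -- Both groups have the finite order of `D_{2n}`, so the inclusion is an equality and `ψ`
    -- factors through the explicit embedding `h.hom`. The factor `f` defines the extension,
    -- whatever `e` was.
    have hrange : h.hom.range = ψ.range := by
      have hfin : Finite ψ.range := Finite.of_equiv _ e.symm.toEquiv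
      refine Subgroup.eq_of_le_of_card_ge hle (le_of_eq ?_)
      rw [Nat.card_congr e.toEquiv, Nat.card_congr (MonoidHom.ofInjective hinj).toEquiv]
    let f : GalK K →* DihedralGroup n :=
      (MonoidHom.ofInjective hinj).symm.toMonoidHom.comp
        (ψ.codRestrict h.hom.range fun ρ => hrange ▸ ⟨ρ, rfl⟩)
    have hf : ∀ ρ, h.hom (f ρ) = ψ ρ := fun ρ =>
      congrArg Subtype.val ((MonoidHom.ofInjective hinj).apply_symm_apply
        (ψ.codRestrict h.hom.range (fun ρ => hrange ▸ ⟨ρ, rfl⟩) ρ))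
    have hflc : IsLocallyConstant f := by
      refine IsLocallyConstant.desc f h.hom ?_ hinj
      rwa [show h.hom ∘ f = ψ from funext hf]
    have hfs : Function.Surjective f := by
      intro g
      obtain ⟨ρ, hρ⟩ : h.hom g ∈ ψ.range := hle ⟨g, rfl⟩
      exact ⟨ρ, hinj ((hf ρ).trans hρ)⟩
    obtain ⟨E, hE⟩ := exists_dihedralExtension f hflc hfs
    obtain rfl : ψ = h.hom.comp E.proj := by
      rw [hE]; exact MonoidHom.ext fun ρ => (hf ρ).symm
    obtain ⟨s, hs⟩ := E.exists_sqrtField_eq_closure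
    obtain ⟨u, hu⟩ := E.exists_sqrtField_eq_r
    obtain ⟨_, hbar, hsign⟩ := h.components hn ι hαpos hb ha E.proj E.isLocallyConstant_proj
    refine ⟨hγ, E, s, u, b, hs, hu, hinv.nonempty_algEquiv hB (hinv.sq_ne_one hn ht) hα, ?_, hsign⟩
    ext ρ
    rw [E.quadMorphism_mul_apply hs hu hodd]
    exact hbar ρ
  · rintro ⟨hγ, E, s, u, b, hs, hu, ⟨e⟩, hbar, hsign⟩
    obtain ⟨z, y, hinv⟩ := exists_isInvertedBy e
    have hb := hinv.pos_of_isTotallyIndefinite hind ι hdneg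
    obtain ⟨x, a, ε, hx, ha, h⟩ := hinv.exists_isDihedralPair hB hn ht ι hα
    have hinj := h.hom_injective hn
    obtain ⟨hγ', hbar', hsign'⟩ := h.components hn ι hαpos hb ha E.proj E.isLocallyConstant_proj
    refine ⟨hγ, h.hom.comp E.proj, E.isLocallyConstant_proj.comp h.hom, ?_, ?_⟩
    · have hrange : (h.hom.comp E.proj).range = h.hom.range := by
        rw [MonoidHom.range_comp, MonoidHom.range_eq_top.2 E.proj_surjective,
          ← MonoidHom.range_eq_map]
      rw [hrange]
      exact ⟨(MonoidHom.ofInjective hinj).symm⟩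
    -- The constructed class and `γ` have the same two components.
    · refine congrArg Subtype.val (eq_of_components ι ⟨_, hγ'⟩ ⟨γ, hγ⟩ ?_ (hsign'.trans hsign.symm))
      ext ρ
      rw [hbar, E.quadMorphism_mul_apply hs hu hodd, hbar']

end Main

end BuildingBlock

end

open BuildingBlock in
theorem mainTheorem6
    -- a totally real number field with a fixed real embedding, giving the sign
    (F : Type*) [Field F] [NumberField F] [NumberField.IsTotallyReal F] (ι : F →+* ℝ)
    -- a totally indefinite quaternion division algebra over it
    (B : Type*) [DivisionRing B] [Algebra F B] [Algebra.IsCentral F B]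
    (hB : Module.finrank F B = 4) (hind : IsTotallyIndefinite F B)
    (K : Type*) [Field K] [NumberField K]
    (n : ℕ) (hn : 2 < n)
    (hD : ∃ H : Subgroup (ProjUnits F B), Nonempty (H ≃* DihedralGroup n))
    (ζ : AlgebraicClosure F) (hζ : IsPrimitiveRoot ζ n) :
    ∃ α d : Fˣ,
      algebraMap F (AlgebraicClosure F) α = 2 + ζ + ζ⁻¹ ∧
      algebraMap F (AlgebraicClosure F) d = (ζ + ζ⁻¹) ^ 2 - 4 ∧
      (∀ γ : H2 (GalK K) Fˣ, γ ∈ DeltaSet F B K (DihedralGroup n) ↔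
        ∃ (hγ : γ ∈ H2two (GalK K) Fˣ) (E : DihedralExtension K n) (s t : Kˣ) (b : Fˣ),
          sqrtField s = E.fixed (Subgroup.closure {E.σ ^ 2, E.τ}) ∧
          sqrtField t = E.fixed (Subgroup.closure {E.σ}) ∧
          Nonempty (B ≃ₐ[F] QuaternionAlgebra F (d : F) 0 (b : F)) ∧
          barComponent ⟨γ, hγ⟩ = quadMorphism s α * quadMorphism t b ∧
          signComponent ι γ = E.signClass hn) ∧
      (Odd n →
        -- the factor `(s, α)_P` and the class of the sign cocycle are trivial
        (∀ (E : DihedralExtension K n) (s : Kˣ),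
          sqrtField s = E.fixed (Subgroup.closure {E.σ ^ 2, E.τ}) →
            quadMorphism (F := F) s α = 1 ∧ E.signClass hn = 1) ∧
        ∀ γ : H2 (GalK K) Fˣ, γ ∈ DeltaSet F B K (DihedralGroup n) ↔
          ∃ (hγ : γ ∈ H2two (GalK K) Fˣ) (E : DihedralExtension K n) (t : Kˣ) (b : Fˣ),
            sqrtField t = E.fixed (Subgroup.closure {E.σ}) ∧
            Nonempty (B ≃ₐ[F] QuaternionAlgebra F (d : F) 0 (b : F)) ∧
            barComponent ⟨γ, hγ⟩ = quadMorphism t b ∧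
            signComponent ι γ = 1) := by
  obtain ⟨H, ⟨e⟩⟩ := hD
  -- The dihedral subgroup puts `ζ + ζ⁻¹` in `F`.
  obtain ⟨t, hζt, ht, -⟩ := exists_isInvertedBy_of_subgroup hB hn H e hζ
  have : NeZero n := ⟨by omega⟩
  obtain ⟨ht1, ht2⟩ := trace_bounds ι hn ht
  have hα0 : 2 + t ≠ 0 := fun h => by
    have := congrArg ι h
    rw [map_add, map_ofNat, map_zero] at this
    linarith
  have hd0 : t ^ 2 - 4 ≠ 0 := fun h => by
    have := congrArg ι h
    rw [map_sub, map_pow, map_ofNat, map_zero] at this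
    nlinarith
  have key := fun γ => mem_deltaSet_iff (K := K) ι hB hind hn hζ hζt ht
    (α := Units.mk0 _ hα0) (d := Units.mk0 _ hd0) rfl rfl γ
  refine ⟨Units.mk0 _ hα0, Units.mk0 _ hd0, ?_, ?_, key, fun hodd => ?_⟩
  · rw [Units.val_mk0, map_add, hζt, map_ofNat, add_assoc]
  · rw [Units.val_mk0, map_sub, map_pow, hζt, map_ofNat]
  have hα : toPmodSq (Units.mk0 _ hα0) = 1 := toPmodSq_eq_one_of_odd hζ hodd hζt rfl
  have hquad : ∀ s : Kˣ, quadMorphism s (Units.mk0 _ hα0) = 1 := fun s => by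
    classical
    ext ρ
    rw [quadMorphism_apply, hα, ite_self, MonoidHom.one_apply]
  refine ⟨fun E s _ => ⟨hquad s, E.signClass_eq_one hn hodd⟩, fun γ => ?_⟩
  rw [key]
  constructor
  · rintro ⟨hγ, E, s, u, b, -, hu, hb, hbar, hsign⟩
    exact ⟨hγ, E, u, b, hu, hb, by rw [hbar, hquad, one_mul],
      by rw [hsign, E.signClass_eq_one hn hodd]⟩
  · rintro ⟨hγ, E, u, b, hu, hb, hbar, hsign⟩
    -- Any such `s` serves, since `(s, α)_P` is trivial for odd `n`.
    obtain ⟨s, hs⟩ := E.exists_sqrtField_eq_closure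
    exact ⟨hγ, E, s, u, b, hs, hu, hb, by rw [hbar, hquad, one_mul],
      by rw [hsign, E.signClass_eq_one hn hodd]⟩
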